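/- Let $(a_\omega(n))_{n\in\mathbb Z}$ and $(V_\omega(n))_{n\in\mathbb Z}$ be real random variables on a probability space (deterministic sequences are allowed, and the variables may be correlated), such that for some $K>0$, almost surely, $1/K\le |a_\omega(n)|\le K$ and $|V_\omega(n)|\le K$ for all $n$. For a finite interval $\Lambda\subset\mathbb Z$ let $H_\omega(\Lambda)$ be the restriction to $\ell^2(\Lambda)$, with Dirichlet boundary conditions, of the Jacobi operator $$(H_\omega u)(n)=a_\omega(n+1)u(n+1)+a_\omega(n)u(n-1)+V_\omega(n)u(n),$$ and put $\Lambda_L=[1,L]\cap\mathbb Z$. Let $\mathcal I\subset\mathbb R$ be open and relatively compact, let $0<s\le 1$, and assume: (IAD) either there is $S\in\mathbb N$ such that, for every finite family of finite non-empty intervals $\Lambda_k\subset\mathbb Z$ with pairwise distances at least $S$, the operators $H_\omega(\Lambda_k)$ are independent; or $V_\omega=0$ and the $a_\omega(n)$ are i.i.d. (the random hopping model); (W) there are $C_W>0$ and $r\ge1$ such that $\mathbb P\big(\mathrm{tr}\,\mathbf 1_{[x,y]}(H_\omega(\Lambda))\ge1\big)\le C_W (y-x)^s|\Lambda|^{r}$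 for all intervals $[x,y]\subset\mathcal I$ and all finite non-empty intervals $\Lambda\subset\mathbb N$; (Loc) for every $\xi\in(0,1)$, $$\sup_{L\ge1}\ \sup_{x\in\Lambda_L}\ \sup_{f}\ \mathbb E\Big(\sum_{y\in\Lambda_L}e^{|x-y|^\xi}\,\big|\langle\delta_x,f(H_\omega(\Lambda_L))\delta_y\rangle\big|\Big)<\infty ,$$ the last supremum being over the Borel functions $f:\mathbb R\to\mathbb R$ with $|f|\le1$ and $\mathrm{supp} f\subset\mathcal I$. Let $J\subset\mathcal I$ be compact. Then for all $s'\in(0,s)$, $M>1$ and $\rho\in(0,1)$ there are $L_0\ge 1$ and $C>0$ such that for all $E\in J$, all integers $L\ge L_0$ and all $\varepsilon\in[L^{-1/s'}/M,\,ML^{-1/s'}]$, $$\sum_{k\ge2}\mathbb P\big(\mathrm{tr}\,\mathbf 1_{[E-\varepsilon,E+\varepsilon]}(H_\omega(\Lambda_L))\ge k\big)\le C\,(\varepsilon^sL)^{1+\rho}.$$ -/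

import Mathlib

open MeasureTheory ProbabilityTheory

noncomputable section

/-- The restriction to `ℓ²(Λ)`, `Λ = [m, n] ∩ ℤ`, with Dirichlet boundary conditions, of the Jacobi
operator `(H u)(i) = a (i + 1) * u (i + 1) + a i * u (i - 1) + v i * u i` on `ℤ`. -/
def jacobiBox (a v : ℤ → ℝ) (m n : ℤ) :
    Matrix (Finset.Icc m n) (Finset.Icc m n) ℝ :=
  Matrix.of fun i j =>
    if (j : ℤ) = i + 1 then a (i + 1)
    else if (j : ℤ) = i - 1 then a i
    else if j = i then v i
    else 0

/-- The random operator `H_ω(Λ)`, `Λ = [m, n] ∩ ℤ`. -/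
def randomJacobi {Ω : Type*} (a V : ℤ → Ω → ℝ) (m n : ℤ) (ω : Ω) :
    Matrix (Finset.Icc m n) (Finset.Icc m n) ℝ :=
  jacobiBox (fun i => a i ω) (fun i => V i ω) m n

/-- `tr (1_B(A))` for a real symmetric matrix `A`, through the functional calculus: the number of
eigenvalues of `A` in `B`, counted with multiplicity. -/
def traceSpectralProj {ι : Type*} [Fintype ι] [DecidableEq ι] (A : Matrix ι ι ℝ) (B : Set ℝ) : ℝ :=
  (cfc (B.indicator fun _ => (1 : ℝ)) A).trace

/-- The coefficients are uniformly bounded and the hopping coefficients are uniformly bounded away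
from zero, almost surely. -/
def BoundedCoefficients {Ω : Type*} [MeasurableSpace Ω] (μ : Measure Ω) (a V : ℤ → Ω → ℝ) : Prop :=
  ∃ K : ℝ, 0 < K ∧ ∀ᵐ ω ∂μ, ∀ n : ℤ, 1 / K ≤ |a n ω| ∧ |a n ω| ≤ K ∧ |V n ω| ≤ K

/-- Independence at a distance: restrictions of the operator to finitely many intervals whose
pairwise distances are at least some fixed `S` are mutually independent. -/
def IndependentAtDistance {Ω : Type*} [MeasurableSpace Ω] (μ : Measure Ω) (a V : ℤ → Ω → ℝ) :
    Prop :=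
  ∃ S : ℕ, ∀ (N : ℕ) (l r : Fin N → ℤ), (∀ k, l k ≤ r k) →
    (∀ k k', k ≠ k' → ∀ x ∈ Finset.Icc (l k) (r k), ∀ y ∈ Finset.Icc (l k') (r k'),
      (S : ℤ) ≤ |x - y|) →
    iIndepFun (m := fun k => (inferInstance :
        MeasurableSpace (Finset.Icc (l k) (r k) → Finset.Icc (l k) (r k) → ℝ)))
      (fun (k : Fin N) (ω : Ω) i j => randomJacobi a V (l k) (r k) ω i j) μ

/-- The random hopping model: no potential and i.i.d. hopping coefficients. -/
def IsRandomHopping {Ω : Type*} [MeasurableSpace Ω] (μ : Measure Ω) (a V : ℤ → Ω → ℝ) : Prop :=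
  (∀ n ω, V n ω = 0) ∧ iIndepFun a μ ∧ ∀ n, IdentDistrib (a n) (a 0) μ μ

/-- Wegner estimate with exponent `s` on `I`, polynomial in the volume, for the intervals
`Λ = [m, n] ∩ ℤ` contained in `ℕ` and the intervals `[x, y] ⊆ I`. -/
def WegnerEstimate {Ω : Type*} [MeasurableSpace Ω] (μ : Measure Ω) (a V : ℤ → Ω → ℝ)
    (I : Set ℝ) (s : ℝ) : Prop :=
  ∃ C r : ℝ, 0 < C ∧ 1 ≤ r ∧ ∀ m n : ℤ, 0 ≤ m → m ≤ n → ∀ x y : ℝ, x ≤ y → Set.Icc x y ⊆ I →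
    μ {ω | 1 ≤ traceSpectralProj (randomJacobi a V m n ω) (Set.Icc x y)} ≤
      ENNReal.ofReal (C * (y - x) ^ s * ((n - m + 1 : ℤ) : ℝ) ^ r)

/-- Localization in `I` for the boxes `[1, L] ∩ ℤ`, uniformly in `L` and in the base point `x`:
subexponential decay, for every exponent `ξ < 1`, of the expected matrix elements of `f(H_ω)`, for
the Borel functions `f` with `|f| ≤ 1` and support in `I`. -/
def Localized {Ω : Type*} [MeasurableSpace Ω] (μ : Measure Ω) (a V : ℤ → Ω → ℝ) (I : Set ℝ) :
    Prop :=
  ∀ ξ : ℝ, 0 < ξ → ξ < 1 → ∃ C : ℝ, ∀ (L : ℕ) (x : Finset.Icc (1 : ℤ) L) (f : ℝ → ℝ),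
    Measurable f → (∀ t, |f t| ≤ 1) → tsupport f ⊆ I →
    ∫⁻ ω, ENNReal.ofReal (∑ y : Finset.Icc (1 : ℤ) L,
        Real.exp (|((y : ℤ) : ℝ) - ((x : ℤ) : ℝ)| ^ ξ) * |cfc f (randomJacobi a V 1 L ω) x y|) ∂μ
      ≤ ENNReal.ofReal C

end

open scoped Matrix

/-! Write γ = s/s' − 1, so that ε^s L is L^{−γ} up to constants. The core is that two eigenvalues
within ε of E cost about L^{−2γ}, with an arbitrarily small loss in the exponent. For this, two
eigenvalues of the large box are turned into two short intervals (length about L^κ, κ small), at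
distance at least S, each with an eigenvalue within D = C₀ε of E. Independence multiplies the two
probabilities, Wegner bounds each by ε^s L^{κr}, and the union over positions and lengths costs
L^{1+κ} for each interval.

Localization makes the kernel P(x,y) of the spectral projection at most τ, a negative power of L,
for |x−y| > ℓ ≈ L^κ, off a very unlikely event. If two sites with P(x,x) ≥ τ are far apart, the
columns of P at these sites, cut off, are approximate eigenvectors of two separated intervals
(`hasEigenvalueIn_of_le_projKernel`). Otherwise the whole range of P lives on one short interval,
which then has two eigenvalues near E itself (`finrank_le_card_of_concentrated`), and this interval
must be split.

The splitting is inverse tunneling (`exists_two_hasEigenvalueIn`), which loses only a constant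
factor in the energy window. Let [p,n] be the shortest initial piece with an eigenvalue within D of
E. If no final piece starting at n+S or later has one, then two eigenvectors u, w normalised by u(n)
= w(n) nearly agree: their ratio u(n−1)/u(n) is a Borel transform with neither pole nor zero in the
window, so its relative variation is O(ε/D) (`exists_boundary_ratio`), and boundedly many transfer
steps cross the gap. The contributions of the two ends to ⟨u,w⟩ are nonnegative and that of the gap
is positive, contradicting orthogonality (`sum_mul_pos_of_noEigenvalue`).

In the sum over k, the bound for two eigenvalues is used for k up to N(2ℓ+S+1). Beyond this there
are N separated sites with P(x,x) ≥ τ, hence N independent events, and a fixed large N beats the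
remaining L+1 terms; for k > L the terms vanish. -/

/-- `ψ` is an orthonormal basis of eigenvectors of `A` with eigenvalues `e`. -/
structure IsEigenbasis {ι : Type*} [Fintype ι] [DecidableEq ι] (A : Matrix ι ι ℝ) (ψ : ι → ι → ℝ)
    (e : ι → ℝ) : Prop where
  orth : ∀ j k, ψ j ⬝ᵥ ψ k = if j = k then 1 else 0
  complete : ∀ x y, ∑ j, ψ j x * ψ j y = if x = y then 1 else 0
  eig : ∀ j, A *ᵥ ψ j = e j • ψ j

/-- `A` has an eigenvalue in `B`. -/
def HasEigenvalueIn {ι : Type*} [Fintype ι] (A : Matrix ι ι ℝ) (B : Set ℝ) : Prop :=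
  ∃ t ∈ B, ∃ w : ι → ℝ, w ≠ 0 ∧ A *ᵥ w = t • w

/-! ### Finite-dimensional spectral theory in an eigenbasis -/

section Spectral

variable {ι : Type*} [Fintype ι] [DecidableEq ι] {A : Matrix ι ι ℝ} {ψ : ι → ι → ℝ} {e : ι → ℝ}

theorem Matrix.IsHermitian.isEigenbasis (hA : A.IsHermitian) :
    IsEigenbasis A (fun j x => hA.eigenvectorBasis j x) hA.eigenvalues where
  orth j k := by
    have h := (orthonormal_iff_ite.mp hA.eigenvectorBasis.orthonormal) j k
    rw [← h]
    simp [dotProduct, PiLp.inner_apply, mul_comm]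
  complete x y := by
    have h := (Matrix.mem_unitaryGroup_iff.mp hA.eigenvectorUnitary.2)
    have h2 := congrFun (congrFun h x) y
    rw [Matrix.mul_apply, Matrix.one_apply] at h2
    rw [← h2]
    simp [Matrix.star_apply, Matrix.IsHermitian.eigenvectorUnitary_apply]
  eig j := hA.mulVec_eigenvectorBasis j

theorem Matrix.IsHermitian.cfc_apply_eq_sum (hA : A.IsHermitian) (f : ℝ → ℝ) (x y : ι) :
    cfc f A x y =
      ∑ j, f (hA.eigenvalues j) * (hA.eigenvectorBasis j x * hA.eigenvectorBasis j y) := by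
  rw [hA.cfc_eq, Matrix.IsHermitian.cfc, Unitary.conjStarAlgAut_apply, Matrix.mul_apply]
  refine Finset.sum_congr rfl fun j _ => ?_
  rw [Matrix.mul_diagonal]
  simp [Matrix.star_apply, Matrix.IsHermitian.eigenvectorUnitary_apply]
  ring

namespace IsEigenbasis

theorem dotProduct_self_eq_one (h : IsEigenbasis A ψ e) (j : ι) : ψ j ⬝ᵥ ψ j = 1 := by
  simp [h.orth]

theorem ne_zero (h : IsEigenbasis A ψ e) (j : ι) : ψ j ≠ 0 := by
  intro h0
  have := h.dotProduct_self_eq_one j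
  simp [h0] at this

theorem expansion (h : IsEigenbasis A ψ e) (w : ι → ℝ) (x : ι) :
    ∑ j, (ψ j ⬝ᵥ w) * ψ j x = w x := by
  simp only [dotProduct, Finset.sum_mul]
  rw [Finset.sum_comm]
  have : ∀ y, ∑ j, ψ j y * w y * ψ j x = w y * (if y = x then 1 else 0) := by
    intro y
    rw [← h.complete y x, Finset.mul_sum]
    exact Finset.sum_congr rfl fun j _ => by ring
  simp [this]

theorem parseval (h : IsEigenbasis A ψ e) (w z : ι → ℝ) :
    ∑ j, (ψ j ⬝ᵥ w) * (ψ j ⬝ᵥ z) = w ⬝ᵥ z := by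
  have : ∀ j, (ψ j ⬝ᵥ w) * (ψ j ⬝ᵥ z) = ∑ x, ((ψ j ⬝ᵥ w) * ψ j x) * z x := by
    intro j
    rw [dotProduct, dotProduct, Finset.mul_sum]
    exact Finset.sum_congr rfl fun x _ => by ring
  simp only [this]
  rw [Finset.sum_comm]
  simp only [← Finset.sum_mul, h.expansion]
  rfl

theorem dotProduct_mulVec (h : IsEigenbasis A ψ e) (hA : A.IsHermitian) (j : ι) (w : ι → ℝ) :
    ψ j ⬝ᵥ (A *ᵥ w) = e j * (ψ j ⬝ᵥ w) := by
  have hT : Aᵀ = A := by rw [← Matrix.conjTranspose_eq_transpose_of_trivial]; exact hA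
  rw [Matrix.dotProduct_mulVec, ← Matrix.mulVec_transpose, hT, h.eig, smul_dotProduct, smul_eq_mul]

theorem eq_zero_of_coeff (h : IsEigenbasis A ψ e) {w : ι → ℝ} (hw : ∀ j, ψ j ⬝ᵥ w = 0) : w = 0 := by
  ext x
  rw [← h.expansion w x]
  simp [hw]

theorem hasEigenvalueIn_iff (h : IsEigenbasis A ψ e) (hA : A.IsHermitian) (B : Set ℝ) :
    HasEigenvalueIn A B ↔ ∃ j, e j ∈ B := by
  constructor
  · rintro ⟨t, ht, w, hw, hAw⟩
    by_contra! hno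
    refine hw (h.eq_zero_of_coeff fun j => ?_)
    have h1 := h.dotProduct_mulVec hA j w
    rw [hAw, dotProduct_smul, smul_eq_mul] at h1
    have h2 : (t - e j) * (ψ j ⬝ᵥ w) = 0 := by linarith
    rcases mul_eq_zero.mp h2 with h3 | h3
    · exact absurd ht (by rw [sub_eq_zero.mp h3]; exact hno j)
    · exact h3
  · rintro ⟨j, hj⟩
    exact ⟨e j, hj, ψ j, h.ne_zero j, h.eig j⟩

theorem sum_sq_sub (h : IsEigenbasis A ψ e) (hA : A.IsHermitian) (E : ℝ) (w : ι → ℝ) :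
    ∑ x, ((A *ᵥ w) x - E * w x) ^ 2 = ∑ j, (e j - E) ^ 2 * (ψ j ⬝ᵥ w) ^ 2 := by
  have h1 := h.parseval (A *ᵥ w - E • w) (A *ᵥ w - E • w)
  have h2 : ∀ j, ψ j ⬝ᵥ (A *ᵥ w - E • w) = (e j - E) * (ψ j ⬝ᵥ w) := by
    intro j
    rw [dotProduct_sub, h.dotProduct_mulVec hA, dotProduct_smul, smul_eq_mul]
    ring
  simp only [h2] at h1
  simp only [dotProduct, Pi.sub_apply, Pi.smul_apply, smul_eq_mul] at h1 ⊢
  rw [Finset.sum_congr rfl fun x _ => pow_two _, ← h1]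
  exact Finset.sum_congr rfl fun x _ => by ring

/-- A space of approximate eigenvectors bounds the number of eigenvalues from below. -/
theorem finrank_le_card (h : IsEigenbasis A ψ e) (hA : A.IsHermitian) (E δ : ℝ)
    (W : Submodule ℝ (ι → ℝ)) (hδ : 0 ≤ δ)
    (hW : ∀ w ∈ W, w ≠ 0 → ∑ x, ((A *ᵥ w) x - E * w x) ^ 2 < δ ^ 2 * ∑ x, w x ^ 2) :
    Module.finrank ℝ W ≤ (Finset.univ.filter fun j => |e j - E| ≤ δ).card := by
  let S := {j // |e j - E| ≤ δ}
  let T : (ι → ℝ) →ₗ[ℝ] (S → ℝ) :=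
    { toFun := fun w j => ψ j ⬝ᵥ w
      map_add' := fun w z => by ext j; simp [dotProduct_add]
      map_smul' := fun c w => by ext j; simp [dotProduct_smul] }
  -- If all coefficients on eigenvalues within δ vanish, the residual is at least δ times the norm.
  -- Hence taking these coefficients is injective on `W`.
  have hinj : Function.Injective (T.domRestrict W) := by
    rw [← LinearMap.ker_eq_bot, LinearMap.ker_eq_bot']
    rintro ⟨w, hw⟩ hTw
    by_contra hne
    have hw0 : w ≠ 0 := fun h0 => hne (by simp [h0])
    have hlt := hW w hw hw0
    rw [h.sum_sq_sub hA] at hlt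
    have hp : ∑ x, w x ^ 2 = ∑ j, (ψ j ⬝ᵥ w) ^ 2 := by
      have := h.parseval w w
      simp only [dotProduct] at this ⊢
      simp only [pow_two, this]
    rw [hp, Finset.mul_sum] at hlt
    refine absurd hlt (not_lt.mpr (Finset.sum_le_sum fun j _ => ?_))
    by_cases hj : |e j - E| ≤ δ
    · have : ψ j ⬝ᵥ w = 0 := congrFun hTw ⟨j, hj⟩
      simp [this]
    · push Not at hj
      refine mul_le_mul_of_nonneg_right ?_ (sq_nonneg _)
      rw [← sq_abs (e j - E)]
      exact pow_le_pow_left₀ hδ hj.le 2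
  have := LinearMap.finrank_le_finrank_of_injective hinj
  simpa [S, Fintype.card_subtype] using this

end IsEigenbasis

theorem traceSpectralProj_eq (hA : A.IsHermitian) (B : Set ℝ) [DecidablePred (· ∈ B)] :
    traceSpectralProj A B = ((Finset.univ.filter fun j => hA.eigenvalues j ∈ B).card : ℝ) := by
  have h := hA.isEigenbasis
  rw [traceSpectralProj, Matrix.trace]
  simp only [Matrix.diag_apply, hA.cfc_apply_eq_sum]
  rw [Finset.sum_comm]
  have : ∀ j, ∑ x, B.indicator (fun _ => (1 : ℝ)) (hA.eigenvalues j) *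
      (hA.eigenvectorBasis j x * hA.eigenvectorBasis j x) =
        if hA.eigenvalues j ∈ B then 1 else 0 := by
    intro j
    rw [← Finset.mul_sum]
    have := h.dotProduct_self_eq_one j
    simp only [dotProduct] at this
    rw [this, mul_one, Set.indicator_apply]
  simp [this]

theorem one_le_traceSpectralProj_iff (hA : A.IsHermitian) (B : Set ℝ) :
    1 ≤ traceSpectralProj A B ↔ HasEigenvalueIn A B := by
  classical
  rw [traceSpectralProj_eq hA, hA.isEigenbasis.hasEigenvalueIn_iff hA, Nat.one_le_cast,
    Nat.succ_le_iff, Finset.card_pos]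
  simp [Finset.Nonempty]

end Spectral

/-! ### Borel transforms without poles or zeros near an energy -/

section Boundary

/-- With m(E) = ∑ w/(e − E), the difference quotient of m over a step D/2 has terms
1/((e−E₁)(e−E₁+D/2)). Up to a factor 2 these dominate 1/((e−E₁)(e−E₂)), because every pole is
farther than D ≥ 6r from E₀. If m is nonnegative at E₁ − D/2, that value can be dropped. -/
theorem sum_inv_mul_inv_le {ι : Type*} [Fintype ι] (w e : ι → ℝ) (hw : ∀ j, 0 ≤ w j)
    {E₀ r D E₁ E₂ : ℝ} (hr : 0 < r) (hD : 6 * r ≤ D) (h₁ : |E₁ - E₀| ≤ r) (h₂ : |E₂ - E₀| ≤ r)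
    (he : ∀ j, D < |e j - E₀|) (hm : 0 ≤ ∑ j, w j / (e j - (E₁ - D / 2))) :
    ∑ j, w j / ((e j - E₁) * (e j - E₂)) ≤ 4 / D * ∑ j, w j / (e j - E₁) := by
  have hD0 : 0 < D := by linarith
  rw [abs_le] at h₁ h₂
  have key : ∀ j, w j / ((e j - E₁) * (e j - E₂)) ≤
      4 / D * (w j / (e j - E₁) - w j / (e j - (E₁ - D / 2))) := by
    intro j
    rcases lt_abs.mp (he j) with h | h
    · have a1 : 0 < e j - E₁ := by linarith
      have a2 : 0 < e j - E₂ := by linarith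
      have a3 : 0 < e j - (E₁ - D / 2) := by linarith
      have : 4 / D * (w j / (e j - E₁) - w j / (e j - (E₁ - D / 2))) =
          w j * 2 / ((e j - E₁) * (e j - (E₁ - D / 2))) := by
        rw [div_sub_div _ _ a1.ne' a3.ne']
        field_simp
        ring
      rw [this, div_le_div_iff₀ (by positivity) (by positivity)]
      have : (e j - (E₁ - D / 2)) ≤ 2 * (e j - E₂) := by linarith
      have := mul_le_mul_of_nonneg_left this (mul_nonneg (hw j) a1.le)
      nlinarith
    · have a1 : 0 < E₁ - e j := by linarith
      have a2 : 0 < E₂ - e j := by linarith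
      have a3 : 0 < (E₁ - D / 2) - e j := by linarith
      have h1 : e j - E₁ ≠ 0 := by linarith
      have h3 : e j - (E₁ - D / 2) ≠ 0 := by linarith
      have e1 : 4 / D * (w j / (e j - E₁) - w j / (e j - (E₁ - D / 2))) =
          w j * 2 / ((E₁ - e j) * ((E₁ - D / 2) - e j)) := by
        rw [show (E₁ - e j) * ((E₁ - D / 2) - e j) = (e j - E₁) * (e j - (E₁ - D / 2)) by ring,
          div_sub_div _ _ h1 h3]
        field_simp
        ring
      rw [e1, show (e j - E₁) * (e j - E₂) = (E₁ - e j) * (E₂ - e j) by ring,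
        div_le_div_iff₀ (by positivity) (by positivity)]
      have : ((E₁ - D / 2) - e j) ≤ 2 * (E₂ - e j) := by linarith
      have := mul_le_mul_of_nonneg_left this (mul_nonneg (hw j) a1.le)
      nlinarith
  calc _ ≤ ∑ j, 4 / D * (w j / (e j - E₁) - w j / (e j - (E₁ - D / 2))) :=
        Finset.sum_le_sum fun j _ => key j
    _ = 4 / D * (∑ j, w j / (e j - E₁) - ∑ j, w j / (e j - (E₁ - D / 2))) := by
        rw [← Finset.mul_sum, Finset.sum_sub_distrib]
    _ ≤ _ := by
        refine mul_le_mul_of_nonneg_left ?_ (by positivity)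
        linarith

/-- The Borel transform of a measure that vanishes on an interval around `E₀`, and that has no zero
there, has a small logarithmic derivative near `E₀`. -/
theorem sum_inv_mul_inv_le_abs {ι : Type*} [Fintype ι] (w e : ι → ℝ) (hw : ∀ j, 0 ≤ w j)
    {E₀ r D E₁ E₂ : ℝ} (hr : 0 < r) (hD : 6 * r ≤ D) (h₁ : |E₁ - E₀| ≤ r) (h₂ : |E₂ - E₀| ≤ r)
    (he : ∀ j, D < |e j - E₀|)
    (hm : ∀ E ∈ Set.Icc (E₀ - D) (E₀ + D), ∑ j, w j / (e j - E) ≠ 0) :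
    ∑ j, w j / ((e j - E₁) * (e j - E₂)) ≤ 4 / D * |∑ j, w j / (e j - E₁)| := by
  have hD0 : 0 < D := by linarith
  have h₁' := abs_le.mp h₁
  by_cases hs : 0 ≤ ∑ j, w j / (e j - (E₁ - D / 2))
  · exact (sum_inv_mul_inv_le w e hw hr hD h₁ h₂ he hs).trans
      (mul_le_mul_of_nonneg_left (le_abs_self _) (by positivity))
  push Not at hs
  -- Without poles or zeros m keeps its sign on the window, so it is also nonpositive at E₁ + D/2.
  -- Reflecting all energies then reduces to the nonnegative case.
  have hs' : ∑ j, w j / (e j - (E₁ + D / 2)) ≤ 0 := by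
    by_contra! hpos
    have hcont : ContinuousOn (fun E => ∑ j, w j / (e j - E))
        (Set.Icc (E₁ - D / 2) (E₁ + D / 2)) := by
      refine continuousOn_finsetSum _ fun j _ => ?_
      refine ContinuousOn.div continuousOn_const (by fun_prop) fun E hE => ?_
      have := he j
      intro h0
      rw [show e j = E by linarith] at this
      have : |E - E₀| ≤ D := abs_le.mpr ⟨by linarith [hE.1], by linarith [hE.2]⟩
      linarith
    obtain ⟨E, hE, h0⟩ := intermediate_value_Icc (by linarith) hcont ⟨hs.le, hpos.le⟩
    exact hm E ⟨by linarith [hE.1], by linarith [hE.2]⟩ h0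
  have hn := sum_inv_mul_inv_le w (fun j => -e j) hw (E₀ := -E₀) (E₁ := -E₁) (E₂ := -E₂) hr hD
    (by rw [← abs_neg]; convert h₁ using 2; ring) (by rw [← abs_neg]; convert h₂ using 2; ring)
    (fun j => by rw [← abs_neg]; convert he j using 2; ring)
    (by
      have : ∑ j, w j / (-e j - (-E₁ - D / 2)) = - ∑ j, w j / (e j - (E₁ + D / 2)) := by
        rw [← Finset.sum_neg_distrib]
        exact Finset.sum_congr rfl fun j _ => by rw [← div_neg]; congr 1; ring
      rw [this]
      linarith)
  have e1 : ∑ j, w j / ((-e j - -E₁) * (-e j - -E₂)) = ∑ j, w j / ((e j - E₁) * (e j - E₂)) :=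
    Finset.sum_congr rfl fun j _ => by congr 1; ring
  have e2 : ∑ j, w j / (-e j - -E₁) = -∑ j, w j / (e j - E₁) := by
    rw [← Finset.sum_neg_distrib]
    exact Finset.sum_congr rfl fun j _ => by rw [← div_neg]; congr 1; ring
  rw [e1, e2] at hn
  exact hn.trans (mul_le_mul_of_nonneg_left (neg_le_abs _) (by positivity))

variable {ι : Type*} [Fintype ι] [DecidableEq ι] {A : Matrix ι ι ℝ}

/-- A solution of (A − E)u = s δ_p has coefficients sψ_j(p)/(e_j − E), so u(p) = s m(E) with m the
Borel transform of the spectral measure at p, and the resolvent identity gives m₂ − m₁ = (E₂ − E₁)q.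
Here q ≥ 0 since E₁ and E₂ lie on the same side of every eigenvalue. Poles of m are excluded by
`hno`, zeros by `hno'`. -/
theorem exists_boundary_ratio (hA : A.IsHermitian) (p : ι) {E₀ r D E₁ E₂ : ℝ} (hr : 0 < r)
    (hD : 6 * r ≤ D) (h₁ : |E₁ - E₀| ≤ r) (h₂ : |E₂ - E₀| ≤ r)
    (hno : ¬ HasEigenvalueIn A (Set.Icc (E₀ - D) (E₀ + D)))
    (hno' : ∀ t ∈ Set.Icc (E₀ - D) (E₀ + D), ∀ z : ι → ℝ, z p = 0 →
      (∀ x, x ≠ p → (A *ᵥ z) x = t * z x) → z = 0) :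
    ∃ m₁ m₂ q : ℝ, 0 ≤ q ∧ |m₂ - m₁| ≤ 8 * r / D * |m₁| ∧
      ∀ (u v : ι → ℝ) (s t : ℝ), A *ᵥ u = E₁ • u + Pi.single p s →
        A *ᵥ v = E₂ • v + Pi.single p t →
        u p = s * m₁ ∧ v p = t * m₂ ∧ u ⬝ᵥ v = s * t * q ∧ (s = 0 → u = 0) := by
  have h := hA.isEigenbasis
  set ψ : ι → ι → ℝ := fun j x => hA.eigenvectorBasis j x
  set e := hA.eigenvalues
  have hD0 : 0 < D := by linarith
  have he : ∀ j, D < |e j - E₀| := by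
    intro j
    by_contra! hj
    rw [abs_le] at hj
    exact hno ((h.hasEigenvalueIn_iff hA _).mpr ⟨j, by linarith, by linarith⟩)
  have hne : ∀ E ∈ Set.Icc (E₀ - D) (E₀ + D), ∀ j, e j - E ≠ 0 := by
    intro E hE j h0
    have := he j
    rw [show e j = E by linarith] at this
    have : |E - E₀| ≤ D := abs_le.mpr ⟨by linarith [hE.1], by linarith [hE.2]⟩
    linarith
  have hmem : ∀ E, |E - E₀| ≤ r → E ∈ Set.Icc (E₀ - D) (E₀ + D) := by
    intro E hE
    rw [abs_le] at hE
    exact ⟨by linarith, by linarith⟩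
  have hcoeff : ∀ E ∈ Set.Icc (E₀ - D) (E₀ + D), ∀ (u : ι → ℝ) (s : ℝ),
      A *ᵥ u = E • u + Pi.single p s → ∀ j, ψ j ⬝ᵥ u = s * ψ j p / (e j - E) := by
    intro E hE u s hu j
    have h1 := h.dotProduct_mulVec hA j u
    rw [hu, dotProduct_add, dotProduct_smul, smul_eq_mul, dotProduct_single] at h1
    rw [eq_div_iff (hne E hE j)]
    linarith
  have hval : ∀ E ∈ Set.Icc (E₀ - D) (E₀ + D), ∀ (u : ι → ℝ) (s : ℝ),
      A *ᵥ u = E • u + Pi.single p s → u p = s * ∑ j, ψ j p ^ 2 / (e j - E) := by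
    intro E hE u s hu
    rw [← h.expansion u p, Finset.mul_sum]
    refine Finset.sum_congr rfl fun j _ => ?_
    rw [hcoeff E hE u s hu]
    ring
  -- At a zero of m, the resolvent column z at p vanishes at p and solves the eigenvalue equation
  -- elsewhere. So z is an eigenvector of the operator with p removed, unless z = 0, which (A − E)z
  -- = δ_p forbids.
  have hm : ∀ E ∈ Set.Icc (E₀ - D) (E₀ + D), ∑ j, ψ j p ^ 2 / (e j - E) ≠ 0 := by
    intro E hE h0
    let z : ι → ℝ := fun x => ∑ j, ψ j p / (e j - E) * ψ j x
    have hz : A *ᵥ z = E • z + Pi.single p 1 := by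
      have hz' : z = ∑ j, (ψ j p / (e j - E)) • ψ j := by ext x; simp [z]
      ext x
      rw [hz', Matrix.mulVec_sum]
      simp only [Matrix.mulVec_smul, h.eig, Finset.sum_apply, Pi.add_apply, Pi.smul_apply,
        smul_eq_mul, Finset.mul_sum]
      have : (Pi.single p (1 : ℝ) : ι → ℝ) x = ∑ j, ψ j p * ψ j x := by
        rw [h.complete p x]
        simp [Pi.single_apply, eq_comm]
      rw [this, ← Finset.sum_add_distrib]
      refine Finset.sum_congr rfl fun j _ => ?_
      have := hne E hE j
      field_simp
      ring
    have hzp : z p = 0 := by rw [hval E hE z 1 hz, h0, mul_zero]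
    have hz0 := hno' E hE z hzp fun x hx => by simp [hz, hx]
    have := congrFun hz p
    simp [hz0] at this
  refine ⟨∑ j, ψ j p ^ 2 / (e j - E₁), ∑ j, ψ j p ^ 2 / (e j - E₂),
    ∑ j, ψ j p ^ 2 / ((e j - E₁) * (e j - E₂)), ?_, ?_, ?_⟩
  · refine Finset.sum_nonneg fun j _ => div_nonneg (sq_nonneg _) ?_
    have := he j
    rw [abs_le] at h₁ h₂
    rcases lt_abs.mp this with h | h
    · exact mul_nonneg (by linarith) (by linarith)
    · exact mul_nonneg_of_nonpos_of_nonpos (by linarith) (by linarith)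
  · have hq := sum_inv_mul_inv_le_abs (fun j => ψ j p ^ 2) e (fun j => sq_nonneg _) hr hD h₁ h₂ he hm
    have hdiff : ∑ j, ψ j p ^ 2 / (e j - E₂) - ∑ j, ψ j p ^ 2 / (e j - E₁) =
        (E₂ - E₁) * ∑ j, ψ j p ^ 2 / ((e j - E₁) * (e j - E₂)) := by
      rw [← Finset.sum_sub_distrib, Finset.mul_sum]
      refine Finset.sum_congr rfl fun j _ => ?_
      have h1 := hne E₁ (hmem _ h₁) j
      have h2 := hne E₂ (hmem _ h₂) j
      field_simp
      ring
    have hq0 : 0 ≤ ∑ j, ψ j p ^ 2 / ((e j - E₁) * (e j - E₂)) := by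
      refine Finset.sum_nonneg fun j _ => div_nonneg (sq_nonneg _) ?_
      have := he j
      rw [abs_le] at h₁ h₂
      rcases lt_abs.mp this with h | h
      · exact mul_nonneg (by linarith) (by linarith)
      · exact mul_nonneg_of_nonpos_of_nonpos (by linarith) (by linarith)
    rw [hdiff, abs_mul, abs_of_nonneg hq0]
    have h12 : |E₂ - E₁| ≤ 2 * r := by
      rw [abs_le] at h₁ h₂ ⊢
      exact ⟨by linarith, by linarith⟩
    calc _ ≤ (2 * r) * (4 / D * |∑ j, ψ j p ^ 2 / (e j - E₁)|) :=
          mul_le_mul h12 hq hq0 (by linarith)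
      _ = _ := by ring
  · intro u v s t hu hv
    refine ⟨hval _ (hmem _ h₁) u s hu, hval _ (hmem _ h₂) v t hv, ?_, ?_⟩
    · rw [← h.parseval u v, Finset.mul_sum]
      refine Finset.sum_congr rfl fun j _ => ?_
      rw [hcoeff _ (hmem _ h₁) u s hu, hcoeff _ (hmem _ h₂) v t hv]
      have h1 := hne E₁ (hmem _ h₁) j
      have h2 := hne E₂ (hmem _ h₂) j
      field_simp
    · intro hs
      refine h.eq_zero_of_coeff fun j => ?_
      rw [hcoeff _ (hmem _ h₁) u s hu, hs]
      simp

end Boundary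

/-! ### Jacobi boxes as Dirichlet problems on the integers -/

/-- The Jacobi operator on functions on `ℤ`. -/
def jacobiOp (a v : ℤ → ℝ) (w : ℤ → ℝ) (i : ℤ) : ℝ :=
  a (i + 1) * w (i + 1) + a i * w (i - 1) + v i * w i

/-- Extension by zero of a function on an integer interval. -/
noncomputable def extendZero {m n : ℤ} (w : Finset.Icc m n → ℝ) (i : ℤ) : ℝ :=
  if h : i ∈ Finset.Icc m n then w ⟨i, h⟩ else 0

section Box

variable {a v : ℤ → ℝ} {m n : ℤ}

theorem extendZero_apply (w : Finset.Icc m n → ℝ) (i : Finset.Icc m n) :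
    extendZero w i = w i := by
  simp only [extendZero, i.2, dif_pos]

theorem extendZero_of_notMem (w : Finset.Icc m n → ℝ) {i : ℤ} (hi : i ∉ Finset.Icc m n) :
    extendZero w i = 0 := by
  simp only [extendZero, hi, dif_neg, not_false_iff]

theorem jacobiBox_isHermitian (a v : ℤ → ℝ) (m n : ℤ) : (jacobiBox a v m n).IsHermitian := by
  ext i j
  simp only [Matrix.conjTranspose_apply, jacobiBox, Matrix.of_apply, star_trivial]
  have h3 : i = j ↔ (i : ℤ) = j := Subtype.ext_iff
  have h4 : j = i ↔ (j : ℤ) = i := Subtype.ext_iff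
  simp only [h3, h4]
  split_ifs <;> first | omega | rfl | exact congrArg _ (by omega)

theorem jacobiBox_mulVec (w : ℤ → ℝ) (i : Finset.Icc m n) :
    (jacobiBox a v m n *ᵥ fun j => w j) i =
      (if (i : ℤ) + 1 ≤ n then a (i + 1) * w (i + 1) else 0) +
        (if m ≤ (i : ℤ) - 1 then a i * w (i - 1) else 0) + v i * w i := by
  have hi := Finset.mem_Icc.mp i.2
  have h1 : (jacobiBox a v m n *ᵥ fun j => w j) i = ∑ j ∈ Finset.Icc m n,
      ((if j = (i : ℤ) + 1 then a (i + 1) * w (i + 1) else 0) +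
        (if j = (i : ℤ) - 1 then a i * w (i - 1) else 0) +
          (if j = (i : ℤ) then v i * w i else 0)) := by
    rw [← Finset.sum_coe_sort (Finset.Icc m n), Matrix.mulVec, dotProduct]
    refine Finset.sum_congr rfl fun j _ => ?_
    have h4 : j = i ↔ (j : ℤ) = i := Subtype.ext_iff
    simp only [jacobiBox, Matrix.of_apply, h4]
    split_ifs with h1 h2 h3 <;> first | omega | simp [*]
  rw [h1, Finset.sum_add_distrib, Finset.sum_add_distrib, Finset.sum_ite_eq', Finset.sum_ite_eq',
    Finset.sum_ite_eq']
  simp only [Finset.mem_Icc]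
  congr 1
  · congr 1
    · exact if_congr (by omega) rfl rfl
    · exact if_congr (by omega) rfl rfl
  · rw [if_pos hi]

theorem jacobiBox_mulVec_of_zero (w : ℤ → ℝ) (hl : w (m - 1) = 0) (hr : w (n + 1) = 0)
    (i : Finset.Icc m n) : (jacobiBox a v m n *ᵥ fun j => w j) i = jacobiOp a v w i := by
  have hi := Finset.mem_Icc.mp i.2
  rw [jacobiBox_mulVec, jacobiOp]
  congr 2
  · split_ifs with h
    · rfl
    · rw [show (i : ℤ) + 1 = n + 1 by omega, hr, mul_zero]
  · split_ifs with h
    · rfl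
    · rw [show (i : ℤ) - 1 = m - 1 by omega, hl, mul_zero]

/-- Zero extension frees eigenvectors from their index type, so that boxes with different ends can
be compared. -/
theorem hasEigenvalueIn_jacobiBox_iff (B : Set ℝ) :
    HasEigenvalueIn (jacobiBox a v m n) B ↔ ∃ t ∈ B, ∃ u : ℤ → ℝ,
      (∀ i ∉ Finset.Icc m n, u i = 0) ∧ (∃ i, u i ≠ 0) ∧
        ∀ i ∈ Finset.Icc m n, jacobiOp a v u i = t * u i := by
  have e1 : m - 1 ∉ Finset.Icc m n := by simp
  have e2 : n + 1 ∉ Finset.Icc m n := by simp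
  constructor
  · rintro ⟨t, ht, w, hw, hAw⟩
    refine ⟨t, ht, extendZero w, fun i => extendZero_of_notMem w, ?_, fun i hi => ?_⟩
    · obtain ⟨i, hi⟩ := Function.ne_iff.mp hw
      exact ⟨i, by rwa [extendZero_apply]⟩
    · have h := jacobiBox_mulVec_of_zero (a := a) (v := v) (extendZero w)
        (extendZero_of_notMem w e1) (extendZero_of_notMem w e2) ⟨i, hi⟩
      simp only [extendZero_apply] at h
      rw [← h, hAw]
      have := extendZero_apply w ⟨i, hi⟩
      simp only at this
      simp [this]
  · rintro ⟨t, ht, u, hu, ⟨i, hi⟩, hA⟩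
    refine ⟨t, ht, fun j => u j, ?_, ?_⟩
    · intro h0
      by_cases him : i ∈ Finset.Icc m n
      · exact hi (congrFun h0 ⟨i, him⟩)
      · exact hi (hu i him)
    · ext j
      rw [jacobiBox_mulVec_of_zero u (hu _ e1) (hu _ e2), hA j j.2]
      rfl

/-- The coefficient a(i) sits on the bond {i−1, i}, whose mirror image {−i, 1−i} carries a(1−i);
hence the shift in the reflected hopping but not in the potential. -/
theorem jacobiOp_reflect (u : ℤ → ℝ) (i : ℤ) :
    jacobiOp (fun i => a (1 - i)) (fun i => v (-i)) (fun i => u (-i)) i = jacobiOp a v u (-i) := by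
  simp only [jacobiOp]
  rw [show 1 - (i + 1) = -i by ring, show -(i + 1) = -i - 1 by ring, show 1 - i = -i + 1 by ring,
    show -(i - 1) = -i + 1 by ring]
  ring

theorem hasEigenvalueIn_jacobiBox_reflect {B : Set ℝ} {m' n' : ℤ} (hm' : m' = -n) (hn' : n' = -m)
    (h : HasEigenvalueIn (jacobiBox (fun i => a (1 - i)) (fun i => v (-i)) m' n') B) :
    HasEigenvalueIn (jacobiBox a v m n) B := by
  subst hm' hn'
  rw [hasEigenvalueIn_jacobiBox_iff] at h ⊢
  obtain ⟨t, ht, u, hu, ⟨i, hi⟩, hA⟩ := h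
  refine ⟨t, ht, fun i => u (-i), fun i hi' => hu _ ?_, ⟨-i, by simpa using hi⟩, fun j hj => ?_⟩
  · simp only [Finset.mem_Icc] at hi' ⊢
    omega
  · rw [← hA (-j) (by simp only [Finset.mem_Icc] at hj ⊢; omega)]
    have := jacobiOp_reflect (a := a) (v := v) (fun i => u (-i)) (-j)
    simp only [neg_neg] at this
    exact this.symm

end Box

/-! ### Boundary ratios at the two ends of an interval -/

section Ends

variable {a v : ℤ → ℝ}

/-- On [p, n−1] a solution is driven only by the source −a(n)u(n) at the last site, so
`exists_boundary_ratio` applies there. Removing that site leaves [p, n−2], which is why this second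
box must also have no eigenvalue in the window. -/
theorem exists_left_ratio {p n : ℤ} (hpn : p ≤ n) {E₀ r D E₁ E₂ : ℝ} (hr : 0 < r)
    (hD : 6 * r ≤ D) (h₁ : |E₁ - E₀| ≤ r) (h₂ : |E₂ - E₀| ≤ r)
    (hno : ¬ HasEigenvalueIn (jacobiBox a v p (n - 1)) (Set.Icc (E₀ - D) (E₀ + D)))
    (hno' : ¬ HasEigenvalueIn (jacobiBox a v p (n - 2)) (Set.Icc (E₀ - D) (E₀ + D))) :
    ∃ m₁ m₂ q : ℝ, 0 ≤ q ∧ |m₂ - m₁| ≤ 8 * r / D * |m₁| ∧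
      ∀ u w : ℤ → ℝ, u (p - 1) = 0 → w (p - 1) = 0 →
        (∀ i ∈ Finset.Icc p (n - 1), jacobiOp a v u i = E₁ * u i) →
        (∀ i ∈ Finset.Icc p (n - 1), jacobiOp a v w i = E₂ * w i) →
        u (n - 1) = m₁ * u n ∧ w (n - 1) = m₂ * w n ∧
          ∑ i ∈ Finset.Icc p (n - 1), u i * w i = q * (u n * w n) ∧
          (u n = 0 → ∀ i ∈ Finset.Icc p (n - 1), u i = 0) := by
  have hD0 : 0 < D := by linarith
  rcases hpn.eq_or_lt with rfl | hlt
  -- For p = n the box is empty and the Dirichlet condition u(p−1) = 0 makes the ratio zero.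
  · refine ⟨0, 0, 0, le_rfl, by simp, fun u w hu hw _ _ => ?_⟩
    simp [hu, hw]
  have hmem : n - 1 ∈ Finset.Icc p (n - 1) := by simp; omega
  let P : Finset.Icc p (n - 1) := ⟨n - 1, hmem⟩
  obtain ⟨m₁, m₂, q, hq, hm, H⟩ := exists_boundary_ratio (jacobiBox_isHermitian a v p (n - 1)) P hr
    hD h₁ h₂ hno (by
      intro t ht z hz hA
      by_contra hne
      refine hno' ((hasEigenvalueIn_jacobiBox_iff _).mpr ⟨t, ht, extendZero z, ?_, ?_, ?_⟩)
      · intro i hi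
        by_cases h : i ∈ Finset.Icc p (n - 1)
        · have : i = n - 1 := by
            simp only [Finset.mem_Icc] at h hi
            omega
          subst this
          exact (extendZero_apply z P).trans hz
        · exact extendZero_of_notMem z h
      · obtain ⟨i, hi⟩ := Function.ne_iff.mp hne
        exact ⟨i, by rwa [extendZero_apply]⟩
      · intro i hi
        have hi' : i ∈ Finset.Icc p (n - 1) := by
          simp only [Finset.mem_Icc] at hi ⊢
          omega
        have hA' := hA ⟨i, hi'⟩ (by
          simp only [P, ne_eq, Subtype.mk.injEq]
          simp only [Finset.mem_Icc] at hi
          omega)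
        have h := jacobiBox_mulVec_of_zero (a := a) (v := v) (extendZero z)
          (extendZero_of_notMem z (i := p - 1) (by simp))
          (extendZero_of_notMem z (i := n - 1 + 1) (by simp)) ⟨i, hi'⟩
        simp only [extendZero_apply] at h
        rw [← h, hA']
        exact congrArg _ (extendZero_apply z ⟨i, hi'⟩).symm)
  have hsol : ∀ (E : ℝ) (u : ℤ → ℝ), u (p - 1) = 0 →
      (∀ i ∈ Finset.Icc p (n - 1), jacobiOp a v u i = E * u i) →
      (jacobiBox a v p (n - 1) *ᵥ fun j : Finset.Icc p (n - 1) => u j) =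
        E • (fun j : Finset.Icc p (n - 1) => u j) + Pi.single P (-(a n * u n)) := by
    intro E u hu hA
    ext i
    have hi := Finset.mem_Icc.mp i.2
    rw [jacobiBox_mulVec, Pi.add_apply, Pi.smul_apply, smul_eq_mul, ← hA i i.2, jacobiOp]
    have e1 : (if p ≤ (i : ℤ) - 1 then a i * u (i - 1) else 0) = a i * u (i - 1) := by
      split_ifs with h
      · rfl
      · rw [show (i : ℤ) - 1 = p - 1 by omega, hu, mul_zero]
    rw [e1]
    by_cases h : (i : ℤ) + 1 ≤ n - 1
    · have : i ≠ P := fun h' => by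
        have : (i : ℤ) = n - 1 := congrArg Subtype.val h'
        omega
      rw [if_pos h, Pi.single_eq_of_ne this]
      ring
    · have h2 : (i : ℤ) = n - 1 := by omega
      have : i = P := Subtype.ext h2
      rw [if_neg h, this, Pi.single_eq_same]
      simp only [P]
      rw [show n - 1 + 1 = n by ring]
      ring
  refine ⟨-(a n * m₁), -(a n * m₂), a n ^ 2 * q, by positivity, ?_, ?_⟩
  · rw [show -(a n * m₂) - -(a n * m₁) = -(a n) * (m₂ - m₁) by ring, abs_mul, abs_neg, abs_neg,
      abs_mul, mul_left_comm]
    exact mul_le_mul_of_nonneg_left hm (abs_nonneg _)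
  · intro u w hu hw hAu hAw
    obtain ⟨h1, h2, h3, h4⟩ := H _ _ _ _ (hsol _ u hu hAu) (hsol _ w hw hAw)
    refine ⟨?_, ?_, ?_, ?_⟩
    · change u (n - 1) = _ at h1
      rw [h1]
      ring
    · change w (n - 1) = _ at h2
      rw [h2]
      ring
    · rw [← Finset.sum_coe_sort]
      change _ = _ at h3
      simp only [dotProduct] at h3
      rw [h3]
      ring
    · intro h0 i hi
      exact congrFun (h4 (by simp [h0])) ⟨i, hi⟩

theorem exists_right_ratio {k q : ℤ} (hkq : k ≤ q) {E₀ r D E₁ E₂ : ℝ} (hr : 0 < r)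
    (hD : 6 * r ≤ D) (h₁ : |E₁ - E₀| ≤ r) (h₂ : |E₂ - E₀| ≤ r)
    (hno : ¬ HasEigenvalueIn (jacobiBox a v (k + 1) q) (Set.Icc (E₀ - D) (E₀ + D)))
    (hno' : ¬ HasEigenvalueIn (jacobiBox a v (k + 2) q) (Set.Icc (E₀ - D) (E₀ + D))) :
    ∃ m₁ m₂ c : ℝ, 0 ≤ c ∧ |m₂ - m₁| ≤ 8 * r / D * |m₁| ∧
      ∀ u w : ℤ → ℝ, u (q + 1) = 0 → w (q + 1) = 0 →
        (∀ i ∈ Finset.Icc (k + 1) q, jacobiOp a v u i = E₁ * u i) →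
        (∀ i ∈ Finset.Icc (k + 1) q, jacobiOp a v w i = E₂ * w i) →
        u (k + 1) = m₁ * u k ∧ w (k + 1) = m₂ * w k ∧
          ∑ i ∈ Finset.Icc (k + 1) q, u i * w i = c * (u k * w k) ∧
          (u k = 0 → ∀ i ∈ Finset.Icc (k + 1) q, u i = 0) := by
  obtain ⟨m₁, m₂, c, hc, hm, H⟩ := exists_left_ratio (a := fun i => a (1 - i))
    (v := fun i => v (-i)) (p := -q) (n := -k) (by omega) hr hD h₁ h₂
    (fun h => hno (hasEigenvalueIn_jacobiBox_reflect rfl (by ring) h))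
    (fun h => hno' (hasEigenvalueIn_jacobiBox_reflect rfl (by ring) h))
  refine ⟨m₁, m₂, c, hc, hm, fun u w hu hw hAu hAw => ?_⟩
  have hop : ∀ (E : ℝ) (u : ℤ → ℝ), (∀ i ∈ Finset.Icc (k + 1) q, jacobiOp a v u i = E * u i) →
      ∀ i ∈ Finset.Icc (-q) (-k - 1),
        jacobiOp (fun i => a (1 - i)) (fun i => v (-i)) (fun i => u (-i)) i = E * u (-i) := by
    intro E u h i hi
    rw [jacobiOp_reflect]
    refine h _ ?_
    simp only [Finset.mem_Icc] at hi ⊢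
    omega
  obtain ⟨h1, h2, h3, h4⟩ := H (fun i => u (-i)) (fun i => w (-i))
    (by rw [show -(-q - 1) = q + 1 by ring]; exact hu)
    (by rw [show -(-q - 1) = q + 1 by ring]; exact hw) (hop _ _ hAu) (hop _ _ hAw)
  simp only [neg_neg] at h1 h2 h3 h4
  rw [show -(-k - 1) = k + 1 by ring] at h1 h2
  refine ⟨h1, h2, ?_, fun h0 i hi => ?_⟩
  · rw [← h3]
    refine Finset.sum_nbij' (fun i => -i) (fun i => -i) ?_ ?_ ?_ ?_ ?_ <;> intro i hi <;>
      simp only [Finset.mem_Icc, neg_neg] at hi ⊢ <;> omega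
  · have := h4 h0 (-i) (by simp only [Finset.mem_Icc] at hi ⊢; omega)
    simpa using this

end Ends

/-! ### Inverse tunneling -/

section Tunneling

variable {a v : ℤ → ℝ} {K F : ℝ}

/-- One transfer step, with a source g. The lower bound 1/K on the hopping allows solving for
w(i+1). -/
theorem abs_le_of_jacobiOp_eq (hK : 0 < K) (ha : ∀ n, 1 / K ≤ |a n| ∧ |a n| ≤ K ∧ |v n| ≤ K)
    {E : ℝ} (hE : |E| ≤ F) {w : ℤ → ℝ} {i : ℤ} {g : ℝ} (h : jacobiOp a v w i = E * w i + g) :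
    |w (i + 1)| + |w i| ≤ (K * (F + 2 * K) + 1) * (|w i| + |w (i - 1)|) + K * |g| := by
  have hF : 0 ≤ F := (abs_nonneg E).trans hE
  obtain ⟨h1, -, -⟩ := ha (i + 1)
  obtain ⟨-, h2, h3⟩ := ha i
  have e1 : a (i + 1) * w (i + 1) = E * w i + g - a i * w (i - 1) - v i * w i := by
    rw [jacobiOp] at h
    linarith
  have e2 : |a (i + 1) * w (i + 1)| ≤ F * |w i| + |g| + K * |w (i - 1)| + K * |w i| := by
    rw [e1]
    refine (abs_sub _ _).trans (add_le_add ((abs_sub _ _).trans (add_le_add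
      ((abs_add_le _ _).trans (add_le_add ?_ le_rfl)) ?_)) ?_) <;> rw [abs_mul]
    · exact mul_le_mul_of_nonneg_right hE (abs_nonneg _)
    · exact mul_le_mul_of_nonneg_right h2 (abs_nonneg _)
    · exact mul_le_mul_of_nonneg_right h3 (abs_nonneg _)
  have e3 : |w (i + 1)| ≤ K * |a (i + 1) * w (i + 1)| := by
    rw [abs_mul, ← mul_assoc]
    have : 1 ≤ K * |a (i + 1)| := by
      rw [div_le_iff₀ hK] at h1
      linarith
    exact le_mul_of_one_le_left (abs_nonneg _) this
  have e4 := mul_le_mul_of_nonneg_left e2 hK.le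
  have := abs_nonneg (w i)
  have := abs_nonneg (w (i - 1))
  have : 0 ≤ K * K * |w i| := by positivity
  have : 0 ≤ K * K * |w (i - 1)| := by positivity
  have : 0 ≤ K * F * |w (i - 1)| := by positivity
  nlinarith

theorem abs_le_of_jacobiOp_eq' (hK : 0 < K) (ha : ∀ n, 1 / K ≤ |a n| ∧ |a n| ≤ K ∧ |v n| ≤ K)
    {E : ℝ} (hE : |E| ≤ F) {w : ℤ → ℝ} {i : ℤ} (h : jacobiOp a v w i = E * w i) :
    |w i| + |w (i - 1)| ≤ (K * (F + 2 * K) + 1) * (|w (i + 1)| + |w i|) := by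
  have := abs_le_of_jacobiOp_eq (a := fun i => a (1 - i)) (v := fun i => v (-i)) (F := F) (E := E)
    (w := fun i => w (-i)) (i := -i) (g := 0) hK (fun n => ⟨(ha _).1, (ha _).2.1, (ha _).2.2⟩) hE
    (by rw [jacobiOp_reflect]; simpa using h)
  rw [show -(-i + 1) = i - 1 by ring, show -(-i - 1) = i + 1 by ring, neg_neg, abs_zero, mul_zero,
    add_zero] at this
  linarith

theorem sum_Icc_split {p n k q : ℤ} (hpn : p ≤ n) (hnk : n ≤ k + 1) (hkq : k ≤ q) (f : ℤ → ℝ) :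
    ∑ i ∈ Finset.Icc p q, f i = ∑ i ∈ Finset.Icc p (n - 1), f i + ∑ i ∈ Finset.Icc n k, f i +
      ∑ i ∈ Finset.Icc (k + 1) q, f i := by
  rw [← Finset.sum_union, ← Finset.sum_union]
  · congr 1
    ext i
    simp only [Finset.mem_union, Finset.mem_Icc]
    omega
  · rw [Finset.disjoint_left]
    intro i
    simp only [Finset.mem_union, Finset.mem_Icc]
    omega
  · rw [Finset.disjoint_left]
    intro i
    simp only [Finset.mem_Icc]
    omega

theorem mul_nonneg_of_abs_sub_le {x y η : ℝ} (hη : η ≤ 1) (h : |y - x| ≤ η * |x|) : 0 ≤ x * y := by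
  have h1 : |y - x| ≤ |x| := h.trans (mul_le_of_le_one_left (abs_nonneg _) hη)
  rcases le_total 0 x with hx | hx
  · rw [abs_of_nonneg hx, abs_le] at h1
    exact mul_nonneg hx (by linarith)
  · rw [abs_of_nonpos hx, abs_le] at h1
    exact mul_nonneg_of_nonpos_of_nonpos hx (by linarith)

theorem abs_mul_add_mul_le (x y s t : ℝ) : |x * s + y * t| ≤ (|y| + |x|) * (|t| + |s|) := by
  refine (abs_add_le _ _).trans ?_
  rw [abs_mul, abs_mul]
  have := mul_nonneg (abs_nonneg y) (abs_nonneg s)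
  have := mul_nonneg (abs_nonneg x) (abs_nonneg t)
  linarith

theorem abs_add_abs_sq_le (x y : ℝ) : (|y| + |x|) ^ 2 ≤ 2 * (x ^ 2 + y ^ 2) := by
  rw [← sq_abs x, ← sq_abs y]
  linarith [sq_nonneg (|y| - |x|)]

/-- Two solutions with nearby energies that agree at a site of a short gap are not orthogonal, when
the intervals on the two sides of the gap have no eigenvalue nearby. -/
theorem sum_mul_pos_of_noEigenvalue (hK : 0 < K)
    (ha : ∀ n, 1 / K ≤ |a n| ∧ |a n| ≤ K ∧ |v n| ≤ K) {S : ℕ} {p n k q : ℤ} (hpn : p ≤ n)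
    (hnk : n ≤ k) (hkq : k ≤ q) (hkS : k < n + S) {E₀ r D E₁ E₂ : ℝ} (hr : 0 < r)
    (hD : 6 * r ≤ D) (h₁ : |E₁ - E₀| ≤ r) (h₂ : |E₂ - E₀| ≤ r) (hF₁ : |E₁| ≤ F) (hF₂ : |E₂| ≤ F)
    (hsmall : 4 * (S + 1) * (K * (F + 2 * K) + 1) ^ (2 * S + 2) *
      (8 * r / D + S * (K * (2 * r))) ≤ 1)
    (hL : ¬ HasEigenvalueIn (jacobiBox a v p (n - 1)) (Set.Icc (E₀ - D) (E₀ + D)))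
    (hL' : ¬ HasEigenvalueIn (jacobiBox a v p (n - 2)) (Set.Icc (E₀ - D) (E₀ + D)))
    (hR : ¬ HasEigenvalueIn (jacobiBox a v (k + 1) q) (Set.Icc (E₀ - D) (E₀ + D)))
    (hR' : ¬ HasEigenvalueIn (jacobiBox a v (k + 2) q) (Set.Icc (E₀ - D) (E₀ + D)))
    {u w : ℤ → ℝ} (hup : u (p - 1) = 0) (hwp : w (p - 1) = 0) (huq : u (q + 1) = 0)
    (hwq : w (q + 1) = 0) (hu : ∀ i ∈ Finset.Icc p q, jacobiOp a v u i = E₁ * u i)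
    (hw : ∀ i ∈ Finset.Icc p q, jacobiOp a v w i = E₂ * w i) (hn : w n = u n) (hn0 : u n ≠ 0) :
    0 < ∑ i ∈ Finset.Icc p q, u i * w i := by
  set Γ := K * (F + 2 * K) + 1 with hΓdef
  set η := 8 * r / D with hηdef
  have hF : 0 ≤ F := (abs_nonneg _).trans hF₁
  have hΓ : 1 ≤ Γ := by
    have : 0 ≤ K * (F + 2 * K) := by positivity
    linarith
  have hΓ0 : 0 < Γ := by linarith
  have hD0 : 0 < D := by linarith
  have hη0 : 0 ≤ η := by positivity
  set c := K * (2 * r) with hc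
  have hc0 : 0 ≤ c := by positivity
  obtain ⟨m₁, m₂, q₁, hq₁, hm, H₁⟩ := exists_left_ratio hpn hr hD h₁ h₂ hL hL'
  obtain ⟨ν₁, ν₂, q₂, hq₂, hν, H₂⟩ := exists_right_ratio hkq hr hD h₁ h₂ hR hR'
  obtain ⟨l1, l2, l3, -⟩ := H₁ u w hup hwp
    (fun i hi => hu i (by simp only [Finset.mem_Icc] at hi ⊢; omega))
    (fun i hi => hw i (by simp only [Finset.mem_Icc] at hi ⊢; omega))
  obtain ⟨r1, r2, r3, -⟩ := H₂ u w huq hwq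
    (fun i hi => hu i (by simp only [Finset.mem_Icc] at hi ⊢; omega))
    (fun i hi => hw i (by simp only [Finset.mem_Icc] at hi ⊢; omega))
  set T : ℝ := |u n| + |u (n - 1)| with hTdef
  have hT0 : 0 < T := by
    have := abs_pos.mpr hn0
    positivity
  have fwd : ∀ j : ℕ, n + j ≤ k + 1 → |u (n + j)| + |u (n + j - 1)| ≤ Γ ^ j * T := by
    intro j
    induction j with
    | zero => intro _; simp [hTdef]
    | succ j ih =>
      intro hj
      push_cast at hj ⊢
      have h := abs_le_of_jacobiOp_eq hK ha hF₁ (g := 0)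
        (by rw [add_zero]; exact hu (n + j) (by simp only [Finset.mem_Icc]; omega))
      rw [show n + ((j : ℤ) + 1) = n + j + 1 by ring, show n + (j : ℤ) + 1 - 1 = n + j by ring]
      have := mul_le_mul_of_nonneg_left (ih (by omega)) hΓ0.le
      rw [pow_succ]
      simp only [abs_zero, mul_zero, add_zero] at h
      linarith
  have bwd : ∀ j : ℕ, n + j ≤ k + 1 → T ≤ Γ ^ j * (|u (n + j)| + |u (n + j - 1)|) := by
    intro j
    induction j with
    | zero => intro _; simp [hTdef]
    | succ j ih =>
      intro hj
      push_cast at hj ⊢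
      have h := abs_le_of_jacobiOp_eq' hK ha hF₁
        (hu (n + j) (by simp only [Finset.mem_Icc]; omega))
      rw [show n + ((j : ℤ) + 1) = n + j + 1 by ring, show n + (j : ℤ) + 1 - 1 = n + j by ring]
      refine (ih (by omega)).trans ?_
      rw [pow_succ, mul_assoc]
      exact mul_le_mul_of_nonneg_left h (by positivity)
  -- The difference solves the E₂-equation with source (E₂ − E₁)u. It vanishes at n by normalisation
  -- and is at most ηT at n−1 by the ratio bound; each transfer step multiplies by Γ and adds a
  -- source term of order r.
  set d : ℤ → ℝ := fun i => w i - u i with hd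
  have dfwd : ∀ j : ℕ, n + j ≤ k + 1 →
      |d (n + j)| + |d (n + j - 1)| ≤ Γ ^ j * (η + j * c) * T := by
    intro j
    induction j with
    | zero =>
      intro _
      have e1 : d n = 0 := by simp [hd, hn]
      have e2 : d (n - 1) = (m₂ - m₁) * u n := by simp only [hd, l1, l2, hn]; ring
      simp only [Nat.cast_zero, add_zero, e1, e2, abs_zero, zero_add, pow_zero, one_mul, zero_mul]
      calc |(m₂ - m₁) * u n| = |m₂ - m₁| * |u n| := abs_mul _ _
        _ ≤ η * |m₁| * |u n| := mul_le_mul_of_nonneg_right hm (abs_nonneg _)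
        _ = η * |u (n - 1)| := by rw [l1, abs_mul]; ring
        _ ≤ η * T := mul_le_mul_of_nonneg_left (by rw [hTdef]; linarith [abs_nonneg (u n)]) hη0
    | succ j ih =>
      intro hj
      push_cast at hj ⊢
      have hmem : n + (j : ℤ) ∈ Finset.Icc p q := by simp only [Finset.mem_Icc]; omega
      have hdop : jacobiOp a v d (n + j) = E₂ * d (n + j) + (E₂ - E₁) * u (n + j) := by
        have h1 := hu _ hmem
        have h2 := hw _ hmem
        simp only [jacobiOp, hd] at h1 h2 ⊢
        linarith
      have h := abs_le_of_jacobiOp_eq hK ha hF₂ hdop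
      rw [show n + ((j : ℤ) + 1) = n + j + 1 by ring, show n + (j : ℤ) + 1 - 1 = n + j by ring]
      have i1 := mul_le_mul_of_nonneg_left (ih (by omega)) hΓ0.le
      have i2 : |E₂ - E₁| ≤ 2 * r := by
        rw [abs_le] at h₁ h₂ ⊢
        exact ⟨by linarith, by linarith⟩
      have i3 : |u (n + j)| ≤ Γ ^ (j + 1) * T := by
        have := fwd j (by omega)
        have h3 : Γ ^ j * T ≤ Γ ^ (j + 1) * T :=
          mul_le_mul_of_nonneg_right (pow_le_pow_right₀ hΓ (by omega)) hT0.le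
        linarith [abs_nonneg (u (n + j - 1))]
      have i4 : K * |(E₂ - E₁) * u (n + j)| ≤ c * (Γ ^ (j + 1) * T) := by
        rw [abs_mul, hc, mul_assoc]
        exact mul_le_mul_of_nonneg_left (mul_le_mul i2 i3 (abs_nonneg _) (by positivity)) hK.le
      calc _ ≤ Γ * (Γ ^ j * (η + j * c) * T) + c * (Γ ^ (j + 1) * T) := by linarith
        _ = _ := by rw [pow_succ]; ring
  set δ := Γ ^ S * (η + S * c) with hδ
  have hδ0 : 0 ≤ δ := by positivity
  have hsmall' : 4 * (S + 1) * Γ ^ (S + 2) * δ ≤ 1 := by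
    refine le_trans (le_of_eq ?_) hsmall
    rw [hδ]
    ring
  have dle : ∀ j : ℕ, n + j ≤ k + 1 → |d (n + j)| + |d (n + j - 1)| ≤ δ * T := by
    intro j hj
    have hjS : j ≤ S := by omega
    refine (dfwd j hj).trans (mul_le_mul_of_nonneg_right ?_ hT0.le)
    refine mul_le_mul (pow_le_pow_right₀ hΓ hjS) ?_ (by positivity) (by positivity)
    have : (j : ℝ) ≤ S := by exact_mod_cast hjS
    have := mul_le_mul_of_nonneg_right this hc0
    linarith
  have ule : ∀ j : ℕ, n + j ≤ k + 1 → |u (n + j)| + |u (n + j - 1)| ≤ Γ ^ S * T := by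
    intro j hj
    have hjS : j ≤ S := by omega
    exact (fwd j hj).trans (mul_le_mul_of_nonneg_right (pow_le_pow_right₀ hΓ hjS) hT0.le)
  have hη1 : η ≤ 1 := by
    have h1 : (1 : ℝ) ≤ Γ ^ (2 * S + 2) := one_le_pow₀ hΓ
    have h2 : 0 ≤ (S : ℝ) * c := by positivity
    have h3 : (1 : ℝ) ≤ 4 * (S + 1) * Γ ^ (2 * S + 2) := by
      have : (0 : ℝ) ≤ S := by positivity
      linarith [mul_nonneg this (zero_le_one.trans h1)]
    have h4 := le_mul_of_one_le_left (add_nonneg hη0 h2) h3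
    linarith
  -- the contribution of the right end
  have hright : 0 ≤ u k * w k := by
    have hj : n + ((k + 1 - n).toNat : ℤ) = k + 1 := by omega
    have b1 := bwd (k + 1 - n).toNat hj.le
    have b2 := dle (k + 1 - n).toNat hj.le
    have hjS : (k + 1 - n).toNat ≤ S := by omega
    rw [hj, add_sub_cancel_right] at b1 b2
    set X := |u (k + 1)| + |u k| with hX
    have b3 : T ≤ Γ ^ S * X := b1.trans
      (mul_le_mul_of_nonneg_right (pow_le_pow_right₀ hΓ hjS) (by positivity))
    have b4 : 4 * (δ * T) ≤ X := by
      have g1 : Γ ^ S * δ * 4 ≤ 1 := by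
        refine le_trans ?_ hsmall'
        have g2 : Γ ^ S ≤ Γ ^ (S + 2) := pow_le_pow_right₀ hΓ (by omega)
        have g4 : Γ ^ S * δ ≤ Γ ^ (S + 2) * δ := mul_le_mul_of_nonneg_right g2 hδ0
        have g5 : 0 ≤ S * (Γ ^ (S + 2) * δ) := by positivity
        linarith
      have hX0 : 0 ≤ X := by positivity
      calc 4 * (δ * T) ≤ 4 * (δ * (Γ ^ S * X)) := by gcongr
        _ = (Γ ^ S * δ * 4) * X := by ring
        _ ≤ 1 * X := mul_le_mul_of_nonneg_right g1 hX0
        _ = X := one_mul X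
    -- The two ratios have the same sign because η ≤ 1, so u(k)w(k) has the sign of u(k)w(k) +
    -- u(k+1)w(k+1). That sum is a sum of squares up to a small error, even when u(k) itself is tiny
    -- or zero.
    have s1 : u k * w k * (1 + ν₁ * ν₂) = u k ^ 2 + u (k + 1) ^ 2 +
        (u k * d k + u (k + 1) * d (k + 1)) := by
      have : u k * w k * (1 + ν₁ * ν₂) = u k * w k + (ν₁ * u k) * (ν₂ * w k) := by ring
      rw [this, ← r1, ← r2]
      simp only [hd]
      ring
    have s2 : |u k * d k + u (k + 1) * d (k + 1)| ≤ X * (δ * T) :=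
      (abs_mul_add_mul_le _ _ _ _).trans (mul_le_mul_of_nonneg_left b2 (by positivity))
    have s3 : X ^ 2 ≤ 2 * (u k ^ 2 + u (k + 1) ^ 2) := abs_add_abs_sq_le _ _
    have s4 : 0 ≤ u k * w k * (1 + ν₁ * ν₂) := by
      rw [s1]
      have hX0 : 0 ≤ X := by positivity
      have := mul_le_mul_of_nonneg_left b4 hX0
      have := (abs_le.mp s2).1
      linarith [sq_nonneg X]
    have s5 := mul_nonneg_of_abs_sub_le hη1 hν
    by_contra! hneg
    have : u k * w k * (1 + ν₁ * ν₂) < 0 := mul_neg_of_neg_of_pos hneg (by linarith)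
    linarith
  -- the contribution of the gap
  have hmid : 0 < ∑ i ∈ Finset.Icc n k, u i * w i := by
    rcases hnk.eq_or_lt with rfl | hlt
    · rw [Finset.Icc_self, Finset.sum_singleton, hn, ← pow_two]
      positivity
    -- The sites n and n+1 alone give squares of total at least T²/(2Γ²), while the cross terms with
    -- d are at most T²/(4Γ²).
    have m1 : ∑ i ∈ Finset.Icc n k, u i * w i =
        ∑ i ∈ Finset.Icc n k, u i ^ 2 + ∑ i ∈ Finset.Icc n k, u i * d i := by
      rw [← Finset.sum_add_distrib]
      exact Finset.sum_congr rfl fun i _ => by simp only [hd]; ring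
    have m2 : u n ^ 2 + u (n + 1) ^ 2 ≤ ∑ i ∈ Finset.Icc n k, u i ^ 2 := by
      rw [← Finset.sum_pair (f := fun i => u i ^ 2) (by omega : n ≠ n + 1)]
      refine Finset.sum_le_sum_of_subset_of_nonneg ?_ fun i _ _ => sq_nonneg _
      intro i hi
      simp only [Finset.mem_insert, Finset.mem_singleton, Finset.mem_Icc] at hi ⊢
      omega
    have m3 : T ^ 2 ≤ Γ ^ 2 * (2 * (u n ^ 2 + u (n + 1) ^ 2)) := by
      have h := bwd 1 (by push_cast; omega)
      simp only [Nat.cast_one, pow_one, add_sub_cancel_right] at h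
      calc T ^ 2 ≤ (Γ * (|u (n + 1)| + |u n|)) ^ 2 := pow_le_pow_left₀ hT0.le h 2
        _ = Γ ^ 2 * (|u (n + 1)| + |u n|) ^ 2 := by ring
        _ ≤ _ := mul_le_mul_of_nonneg_left (abs_add_abs_sq_le _ _) (by positivity)
    have m4 : |∑ i ∈ Finset.Icc n k, u i * d i| ≤ S * (Γ ^ S * T * (δ * T)) := by
      refine (Finset.abs_sum_le_sum_abs _ _).trans ?_
      have hb : ∀ i ∈ Finset.Icc n k, |u i * d i| ≤ Γ ^ S * T * (δ * T) := by
        intro i hi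
        rw [Finset.mem_Icc] at hi
        have hj : n + ((i - n).toNat : ℤ) = i := by omega
        have b1 := ule (i - n).toNat (by omega)
        have b2 := dle (i - n).toNat (by omega)
        rw [hj] at b1 b2
        rw [abs_mul]
        exact mul_le_mul (by linarith [abs_nonneg (u (i - 1))]) (by linarith [abs_nonneg (d (i - 1))])
          (abs_nonneg _) (by positivity)
      refine (Finset.sum_le_card_nsmul _ _ _ hb).trans ?_
      rw [nsmul_eq_mul]
      refine mul_le_mul_of_nonneg_right ?_ (by positivity)
      rw [Int.card_Icc]
      exact_mod_cast (by omega : (k + 1 - n).toNat ≤ S)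
    have m5 : Γ ^ 2 * (S * (Γ ^ S * T * (δ * T))) ≤ T ^ 2 / 4 := by
      have : Γ ^ 2 * (S * (Γ ^ S * T * (δ * T))) = (S * Γ ^ (S + 2) * δ) * T ^ 2 := by ring
      rw [this]
      have g5 : 0 ≤ Γ ^ (S + 2) * δ := by positivity
      have : S * Γ ^ (S + 2) * δ ≤ 1 / 4 := by linarith
      have := mul_le_mul_of_nonneg_right this (sq_nonneg T)
      linarith
    have m6 := (abs_le.mp m4).1
    rw [m1]
    have hΓ2 : 0 < Γ ^ 2 := by positivity
    have m7 : 0 < Γ ^ 2 * (∑ i ∈ Finset.Icc n k, u i ^ 2 + ∑ i ∈ Finset.Icc n k, u i * d i) := by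
      have t1 := mul_le_mul_of_nonneg_left m2 hΓ2.le
      have t2 := mul_le_mul_of_nonneg_left m6 hΓ2.le
      have t3 : 0 < T ^ 2 := by positivity
      linarith
    exact pos_of_mul_pos_right m7 hΓ2.le
  rw [sum_Icc_split hpn (by omega) hkq, l3, r3, hn]
  have : 0 ≤ u n * u n := mul_self_nonneg _
  positivity

end Tunneling

section Tunneling

variable {a v : ℤ → ℝ} {K F : ℝ}

/-- The empty box has no nonzero vector. This convention covers minimal pieces of one site and gaps
that reach the right end. -/
theorem le_of_hasEigenvalueIn_jacobiBox {m n : ℤ} {B : Set ℝ}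
    (h : HasEigenvalueIn (jacobiBox a v m n) B) : m ≤ n := by
  obtain ⟨t, -, u, hu, ⟨i, hi⟩, -⟩ := (hasEigenvalueIn_jacobiBox_iff B).mp h
  by_contra hmn
  exact hi (hu i (by simp only [Finset.mem_Icc]; omega))

theorem eq_zero_of_jacobiOp_eq (ha : ∀ n, a n ≠ 0) {n q : ℤ} {E : ℝ} {u : ℤ → ℝ}
    (hu : ∀ i ∈ Finset.Icc n q, jacobiOp a v u i = E * u i) (h0 : u (n - 1) = 0) (h1 : u n = 0) :
    ∀ i ∈ Finset.Icc n q, u i = 0 := by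
  have key : ∀ j : ℕ, n + j ≤ q + 1 → u (n + j) = 0 ∧ u (n + j - 1) = 0 := by
    intro j
    induction j with
    | zero => intro _; simpa using ⟨h1, h0⟩
    | succ j ih =>
      intro hj
      push_cast at hj ⊢
      obtain ⟨i1, i2⟩ := ih (by omega)
      have h := hu (n + j) (by simp only [Finset.mem_Icc]; omega)
      rw [jacobiOp, i1, i2, mul_zero, mul_zero, mul_zero, add_zero, add_zero] at h
      rw [show n + ((j : ℤ) + 1) = n + j + 1 by ring, show n + (j : ℤ) + 1 - 1 = n + j by ring]
      exact ⟨(mul_eq_zero.mp h).resolve_left (ha _), i1⟩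
  intro i hi
  rw [Finset.mem_Icc] at hi
  have := (key (i - n).toNat (by omega)).1
  rwa [show n + ((i - n).toNat : ℤ) = i by omega] at this

/-- Inverse tunneling: an interval with two nearby eigenvalues contains two subintervals, separated
by a gap, each of which has an eigenvalue nearby. -/
theorem exists_two_hasEigenvalueIn (hK : 0 < K)
    (ha : ∀ n, 1 / K ≤ |a n| ∧ |a n| ≤ K ∧ |v n| ≤ K) {S : ℕ} (hS : 1 ≤ S) {p q : ℤ}
    {E₀ r D E₁ E₂ : ℝ} (hr : 0 < r)
    (hD : 6 * r ≤ D) (h₁ : |E₁ - E₀| ≤ r) (h₂ : |E₂ - E₀| ≤ r) (hF₁ : |E₁| ≤ F) (hF₂ : |E₂| ≤ F)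
    (hsmall : 4 * (S + 1) * (K * (F + 2 * K) + 1) ^ (2 * S + 2) *
      (8 * r / D + S * (K * (2 * r))) ≤ 1)
    {u w : Finset.Icc p q → ℝ} (hu0 : u ≠ 0) (hw0 : w ≠ 0)
    (hu : jacobiBox a v p q *ᵥ u = E₁ • u) (hw : jacobiBox a v p q *ᵥ w = E₂ • w)
    (huw : u ⬝ᵥ w = 0) :
    ∃ n n' : ℤ, n + S ≤ n' ∧
      HasEigenvalueIn (jacobiBox a v p n) (Set.Icc (E₀ - D) (E₀ + D)) ∧
      HasEigenvalueIn (jacobiBox a v n' q) (Set.Icc (E₀ - D) (E₀ + D)) := by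
  set J := Set.Icc (E₀ - D) (E₀ + D) with hJ
  have hane : ∀ n, a n ≠ 0 := by
    intro n h0
    have := (ha n).1
    rw [h0, abs_zero] at this
    have : 0 < 1 / K := by positivity
    linarith
  have hfull : HasEigenvalueIn (jacobiBox a v p q) J := by
    refine ⟨E₁, ?_, u, hu0, hu⟩
    rw [abs_le] at h₁
    exact ⟨by linarith, by linarith⟩
  have hpq := le_of_hasEigenvalueIn_jacobiBox hfull
  have hex : ∃ j : ℕ, HasEigenvalueIn (jacobiBox a v p (p + j)) J :=
    ⟨(q - p).toNat, by rwa [show p + ((q - p).toNat : ℤ) = q by omega]⟩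
  classical
  obtain ⟨n, hn, hmin⟩ : ∃ n : ℤ, HasEigenvalueIn (jacobiBox a v p n) J ∧
      ∀ l < n, ¬ HasEigenvalueIn (jacobiBox a v p l) J := by
    refine ⟨p + Nat.find hex, Nat.find_spec hex, fun l hl hE => ?_⟩
    have hpl := le_of_hasEigenvalueIn_jacobiBox hE
    refine Nat.find_min hex (m := (l - p).toNat) (by omega) ?_
    rwa [show p + ((l - p).toNat : ℤ) = l by omega]
  have hpn := le_of_hasEigenvalueIn_jacobiBox hn
  have hnq : n ≤ q := by
    by_contra! h
    exact hmin q h hfull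
  by_contra! hno
  -- The gap is [n, min(n+S−1, q)]. Beyond it, either the separation n+S ≤ l holds and the
  -- assumption applies, or l > q and the box is empty.
  have hright : ∀ l, min (n + S - 1) q < l → ¬ HasEigenvalueIn (jacobiBox a v l q) J := by
    intro l hl hE
    have := le_of_hasEigenvalueIn_jacobiBox hE
    exact hno n l (by omega) hn hE
  have e1 : p - 1 ∉ Finset.Icc p q := by simp
  have e2 : q + 1 ∉ Finset.Icc p q := by simp
  have hop : ∀ {E : ℝ} {u : Finset.Icc p q → ℝ}, jacobiBox a v p q *ᵥ u = E • u →
      ∀ i ∈ Finset.Icc p q, jacobiOp a v (extendZero u) i = E * extendZero u i := by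
    intro E u hu i hi
    have h := jacobiBox_mulVec_of_zero (a := a) (v := v) (extendZero u)
      (extendZero_of_notMem u e1) (extendZero_of_notMem u e2) ⟨i, hi⟩
    simp only [extendZero_apply] at h
    rw [← h, hu, Pi.smul_apply, smul_eq_mul]
    exact congrArg _ (extendZero_apply u ⟨i, hi⟩).symm
  -- If u(n) = 0, then u vanishes on [p, n−1], where there is no eigenvalue nearby, and the
  -- recursion carries two adjacent zeros to the right end.
  have hne : ∀ {E : ℝ} {u : Finset.Icc p q → ℝ}, |E - E₀| ≤ r → u ≠ 0 →
      jacobiBox a v p q *ᵥ u = E • u → extendZero u n ≠ 0 := by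
    intro E u hE hu0 hu h0
    obtain ⟨m₁, m₂, c, -, -, H⟩ := exists_left_ratio hpn hr hD hE hE (hmin _ (by omega))
      (hmin _ (by omega))
    have hop' : ∀ i ∈ Finset.Icc p (n - 1),
        jacobiOp a v (extendZero u) i = E * extendZero u i :=
      fun i hi => hop hu i (by simp only [Finset.mem_Icc] at hi ⊢; omega)
    obtain ⟨l1, -, -, l4⟩ := H (extendZero u) (extendZero u) (extendZero_of_notMem u e1)
      (extendZero_of_notMem u e1) hop' hop'
    have hr := eq_zero_of_jacobiOp_eq hane (n := n) (q := q)
      (fun i hi => hop hu i (by simp only [Finset.mem_Icc] at hi ⊢; omega))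
      (by rw [l1, h0, mul_zero]) h0
    refine hu0 (funext fun i => ?_)
    have hi := Finset.mem_Icc.mp i.2
    rw [← extendZero_apply u i]
    by_cases h : (i : ℤ) ≤ n - 1
    · exact l4 h0 i (Finset.mem_Icc.mpr ⟨hi.1, h⟩)
    · exact hr i (Finset.mem_Icc.mpr ⟨by omega, hi.2⟩)
  have hun := hne h₁ hu0 hu
  have hwn := hne h₂ hw0 hw
  have hw' : jacobiBox a v p q *ᵥ ((extendZero u n / extendZero w n) • w) =
      E₂ • ((extendZero u n / extendZero w n) • w) := by
    rw [Matrix.mulVec_smul, hw, smul_comm]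
  have hext : ∀ i, extendZero ((extendZero u n / extendZero w n) • w) i =
      extendZero u n / extendZero w n * extendZero w i := by
    intro i
    by_cases hi : i ∈ Finset.Icc p q
    · simp [extendZero, hi]
    · simp [extendZero_of_notMem, hi]
  have hpos := sum_mul_pos_of_noEigenvalue hK ha (S := S) (k := min (n + S - 1) q) hpn (by omega)
    (by omega) (by omega) hr hD h₁ h₂ hF₁ hF₂ hsmall (hmin _ (by omega)) (hmin _ (by omega))
    (hright _ (by omega)) (hright _ (by omega)) (extendZero_of_notMem u e1)
    (extendZero_of_notMem _ e1) (extendZero_of_notMem u e2) (extendZero_of_notMem _ e2)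
    (hop hu) (hop hw') (by rw [hext, div_mul_cancel₀ _ hwn]) hun
  rw [← Finset.sum_coe_sort] at hpos
  simp only [extendZero_apply, Pi.smul_apply, smul_eq_mul] at hpos
  have : ∑ i, u i * (extendZero u n / extendZero w n * w i) =
      extendZero u n / extendZero w n * (u ⬝ᵥ w) := by
    rw [dotProduct, Finset.mul_sum]
    exact Finset.sum_congr rfl fun i _ => by ring
  rw [this, huw, mul_zero] at hpos
  exact lt_irrefl _ hpos

end Tunneling

/-! ### Restriction of concentrated approximate eigenvectors -/

section Truncation

variable {a v : ℤ → ℝ} {K : ℝ}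

theorem sum_sq_restrict_le {p q l r : ℤ} (hsub : ∀ i ∈ Finset.Icc l r, i ∈ Finset.Icc p q)
    (f : Finset.Icc p q → ℝ) (hf : ∀ x, 0 ≤ f x) :
    ∑ i : Finset.Icc l r, f ⟨i, hsub i i.2⟩ ≤ ∑ x, f x := by
  have hinj : Function.Injective fun i : Finset.Icc l r => (⟨i, hsub i i.2⟩ : Finset.Icc p q) :=
    fun i j hij => Subtype.ext (congrArg (fun x : Finset.Icc p q => (x : ℤ)) hij)
  rw [← Finset.sum_image (f := f) (s := Finset.univ) hinj.injOn]
  exact Finset.sum_le_sum_of_subset_of_nonneg (Finset.subset_univ _) fun x _ _ => hf x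

/-- Approximate eigenvectors of a large box that are small off an interval give eigenvalues of that
interval. -/
theorem finrank_le_card_of_concentrated (ha : ∀ n, |a n| ≤ K) {p q l r : ℤ}
    (hpl : p ≤ l) (hrq : r ≤ q) {E ε τ : ℝ} (hε : 0 < ε) (hτ0 : 0 ≤ τ)
    (hτ : 12 * (Fintype.card (Finset.Icc p q) : ℝ) * K ^ 2 * τ ≤ ε ^ 2)
    (hτ' : 4 * (Fintype.card (Finset.Icc p q) : ℝ) * τ ≤ 1)
    (W : Submodule ℝ (Finset.Icc p q → ℝ))
    (hW : ∀ w ∈ W, ∑ x, ((jacobiBox a v p q *ᵥ w) x - E * w x) ^ 2 ≤ ε ^ 2 * ∑ x, w x ^ 2)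
    (hW' : ∀ w ∈ W, ∀ y : Finset.Icc p q, (y : ℤ) ∉ Finset.Icc l r →
      w y ^ 2 ≤ τ * ∑ x, w x ^ 2) :
    Module.finrank ℝ W ≤ (Finset.univ.filter fun j =>
      |(jacobiBox_isHermitian a v l r).eigenvalues j - E| ≤ 2 * ε).card := by
  set n : ℝ := (Fintype.card (Finset.Icc p q) : ℝ) with hn
  have hsub : ∀ i, i ∈ Finset.Icc l r → i ∈ Finset.Icc p q := by
    intro i hi
    simp only [Finset.mem_Icc] at hi ⊢
    omega
  let ρ : (Finset.Icc p q → ℝ) →ₗ[ℝ] (Finset.Icc l r → ℝ) :=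
    LinearMap.funLeft ℝ ℝ fun i => ⟨i, hsub i i.2⟩
  have hρ : ∀ w i, ρ w i = w ⟨i, hsub i i.2⟩ := fun w i => rfl
  -- The lost mass is at most card · τ ≤ 1/4 of the total.
  have hmass : ∀ w ∈ W, 3 * ∑ x, w x ^ 2 ≤ 4 * ∑ i, ρ w i ^ 2 := by
    intro w hw
    set N := ∑ x, w x ^ 2 with hN
    have hN0 : 0 ≤ N := Finset.sum_nonneg fun _ _ => sq_nonneg _
    have h1 : N ≤ ∑ i, ρ w i ^ 2 + n * (τ * N) := by
      have e1 : ∀ x : Finset.Icc p q, w x ^ 2 ≤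
          (if (x : ℤ) ∈ Finset.Icc l r then w x ^ 2 else 0) + τ * N := by
        intro x
        split_ifs with h
        · have : 0 ≤ τ * N := by positivity
          linarith
        · rw [zero_add]
          exact hW' w hw x h
      have e2 : ∑ i, ρ w i ^ 2 =
          ∑ x : Finset.Icc p q, if (x : ℤ) ∈ Finset.Icc l r then w x ^ 2 else 0 := by
        rw [← Finset.sum_filter]
        refine Finset.sum_bij' (fun i _ => ⟨i, hsub i i.2⟩) (fun x hx => ⟨x, ?_⟩) ?_ ?_ ?_ ?_ ?_
        · exact (Finset.mem_filter.mp hx).2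
        · intro i _
          exact Finset.mem_filter.mpr ⟨Finset.mem_univ _, i.2⟩
        all_goals simp [hρ]
      rw [e2]
      calc N ≤ _ := Finset.sum_le_sum fun x _ => e1 x
        _ = _ := by simp [Finset.sum_add_distrib, hn]
    have h2 := mul_le_mul_of_nonneg_right hτ' hN0
    linarith
  -- Cutting removes only the hopping terms b₁, b₂ across the two ends, and these see values of w
  -- outside the interval. With b = b₁ + b₂, use (X − b)² ≤ 3X²/2 + 3b² and b² ≤ 4M.
  have hres : ∀ w ∈ W, ∀ i : Finset.Icc l r,
      ((jacobiBox a v l r *ᵥ ρ w) i - E * ρ w i) ^ 2 ≤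
        3 / 2 * ((jacobiBox a v p q *ᵥ w) ⟨i, hsub i i.2⟩ - E * w ⟨i, hsub i i.2⟩) ^ 2 +
          12 * (K ^ 2 * (τ * ∑ x, w x ^ 2)) := by
    intro w hw i
    set M := K ^ 2 * (τ * ∑ x, w x ^ 2) with hM
    have hM0 : 0 ≤ M :=
      mul_nonneg (sq_nonneg _) (mul_nonneg hτ0 (Finset.sum_nonneg fun _ _ => sq_nonneg _))
    have hi := Finset.mem_Icc.mp i.2
    have eA := jacobiBox_mulVec (a := a) (v := v) (extendZero w) (⟨i, hsub i i.2⟩ : Finset.Icc p q)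
    have eB := jacobiBox_mulVec (a := a) (v := v) (extendZero w) i
    simp only [extendZero_apply] at eA
    have eρ : (fun j : Finset.Icc l r => extendZero w j) = ρ w := by
      ext j
      rw [hρ]
      exact extendZero_apply w ⟨j, hsub j j.2⟩
    rw [eρ] at eB
    have hiv : extendZero w (i : ℤ) = w ⟨i, hsub i i.2⟩ := extendZero_apply w ⟨i, hsub i i.2⟩
    have hb : ∀ (k k' : ℤ), k ∉ Finset.Icc l r → k ∈ Finset.Icc p q →
        (a k' * extendZero w k) ^ 2 ≤ M := by
      intro k k' hk hk'
      rw [mul_pow, hM]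
      refine mul_le_mul ?_ ?_ (sq_nonneg _) (sq_nonneg _)
      · rw [← sq_abs (a k')]
        exact pow_le_pow_left₀ (abs_nonneg _) (ha k') 2
      · rw [show extendZero w k = w ⟨k, hk'⟩ from extendZero_apply w ⟨k, hk'⟩]
        exact hW' w hw ⟨k, hk'⟩ hk
    set b₁ := (if (i : ℤ) + 1 ≤ q then a (i + 1) * extendZero w (i + 1) else 0) -
      (if (i : ℤ) + 1 ≤ r then a (i + 1) * extendZero w (i + 1) else 0) with hb₁
    set b₂ := (if p ≤ (i : ℤ) - 1 then a i * extendZero w (i - 1) else 0) -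
      (if l ≤ (i : ℤ) - 1 then a i * extendZero w (i - 1) else 0) with hb₂
    have hb₁' : b₁ ^ 2 ≤ M := by
      rw [hb₁]
      split_ifs with h1 h2 h2
      · simpa using hM0
      · rw [sub_zero]
        exact hb _ _ (by simp only [Finset.mem_Icc]; omega) (by simp only [Finset.mem_Icc]; omega)
      · omega
      · simpa using hM0
    have hb₂' : b₂ ^ 2 ≤ M := by
      rw [hb₂]
      split_ifs with h1 h2 h2
      · simpa using hM0
      · rw [sub_zero]
        exact hb _ _ (by simp only [Finset.mem_Icc]; omega) (by simp only [Finset.mem_Icc]; omega)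
      · omega
      · simpa using hM0
    have hdiff : (jacobiBox a v l r *ᵥ ρ w) i - E * ρ w i =
        ((jacobiBox a v p q *ᵥ w) ⟨i, hsub i i.2⟩ - E * w ⟨i, hsub i i.2⟩) - (b₁ + b₂) := by
      rw [eA, eB, hρ, hb₁, hb₂, hiv]
      ring
    rw [hdiff]
    set X := (jacobiBox a v p q *ᵥ w) ⟨i, hsub i i.2⟩ - E * w ⟨i, hsub i i.2⟩
    nlinarith [sq_nonneg (X + 2 * (b₁ + b₂)), sq_nonneg (b₁ - b₂)]
  have hinj : Function.Injective (ρ.domRestrict W) := by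
    rw [← LinearMap.ker_eq_bot, LinearMap.ker_eq_bot']
    rintro ⟨w, hw⟩ h0
    have h := hmass w hw
    rw [show ρ w = 0 from h0] at h
    have h1 : ∑ x, w x ^ 2 = 0 :=
      le_antisymm (by
        simp only [Pi.zero_apply, ne_eq, OfNat.ofNat_ne_zero, not_false_eq_true, zero_pow,
          Finset.sum_const_zero, mul_zero] at h
        linarith) (Finset.sum_nonneg fun _ _ => sq_nonneg _)
    rw [Finset.sum_eq_zero_iff_of_nonneg fun _ _ => sq_nonneg _] at h1
    exact Subtype.ext (funext fun x => by simpa using h1 x (Finset.mem_univ x))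
  rw [← LinearMap.finrank_range_of_inj hinj, LinearMap.range_domRestrict]
  refine ((jacobiBox_isHermitian a v l r).isEigenbasis).finrank_le_card
    (jacobiBox_isHermitian a v l r) E (2 * ε) (W.map ρ) (by positivity) ?_
  rintro _ ⟨w, hw, rfl⟩ hne
  set N := ∑ x, w x ^ 2 with hN
  have hN0 : 0 < N := by
    obtain ⟨i, hi⟩ := Function.ne_iff.mp hne
    exact Finset.sum_pos' (fun _ _ => sq_nonneg _)
      ⟨⟨i, hsub i i.2⟩, Finset.mem_univ _, sq_pos_of_ne_zero hi⟩
  have hcard : (Fintype.card (Finset.Icc l r) : ℝ) ≤ n := by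
    rw [hn]
    exact_mod_cast Fintype.card_le_of_injective
      (fun i : Finset.Icc l r => (⟨i, hsub i i.2⟩ : Finset.Icc p q))
      fun i j hij => Subtype.ext (congrArg (fun x : Finset.Icc p q => (x : ℤ)) hij)
  -- The residual is at most (3/2 + 1)ε²N < 3ε²N, and N ≤ (4/3) of the restricted mass; this gives
  -- the window 2ε.
  calc ∑ i, ((jacobiBox a v l r *ᵥ ρ w) i - E * ρ w i) ^ 2
      ≤ 3 / 2 * ∑ i : Finset.Icc l r,
          ((jacobiBox a v p q *ᵥ w) ⟨i, hsub i i.2⟩ - E * w ⟨i, hsub i i.2⟩) ^ 2 +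
            Fintype.card (Finset.Icc l r) * (12 * (K ^ 2 * (τ * N))) := by
        refine (Finset.sum_le_sum fun i _ => hres w hw i).trans (le_of_eq ?_)
        rw [Finset.sum_add_distrib, ← Finset.mul_sum, Finset.sum_const, Finset.card_univ,
          nsmul_eq_mul]
    _ ≤ 3 / 2 * (ε ^ 2 * N) + n * (12 * (K ^ 2 * (τ * N))) := by
        gcongr
        exact (sum_sq_restrict_le hsub
          (fun x => ((jacobiBox a v p q *ᵥ w) x - E * w x) ^ 2) fun _ => sq_nonneg _).trans (hW w hw)
    _ = 3 / 2 * (ε ^ 2 * N) + (12 * n * K ^ 2 * τ) * N := by ring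
    _ ≤ 3 / 2 * (ε ^ 2 * N) + ε ^ 2 * N := by gcongr
    _ < 3 * (ε ^ 2 * N) := by nlinarith [mul_pos (pow_pos hε 2) hN0]
    _ = ε ^ 2 * (3 * N) := by ring
    _ ≤ ε ^ 2 * (4 * ∑ i, ρ w i ^ 2) := mul_le_mul_of_nonneg_left (hmass w hw) (by positivity)
    _ = (2 * ε) ^ 2 * ∑ i, ρ w i ^ 2 := by ring

end Truncation

/-! ### The kernel of a spectral projection -/

section Kernel

variable {ι : Type*} [Fintype ι] [DecidableEq ι] {A : Matrix ι ι ℝ} {ψ : ι → ι → ℝ} {e : ι → ℝ}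

/-- The kernel of the orthogonal projection onto the span of the `ψ j`, `j ∈ T`. -/
def projKernel (ψ : ι → ι → ℝ) (T : Finset ι) (x y : ι) : ℝ := ∑ j ∈ T, ψ j x * ψ j y

/-- The span of the `ψ j`, `j ∈ T`. -/
def projRange (ψ : ι → ι → ℝ) (T : Finset ι) : Submodule ℝ (ι → ℝ) :=
  Submodule.span ℝ (Set.range fun j : T => ψ j)

omit [Fintype ι] [DecidableEq ι] in
theorem projKernel_mem (T : Finset ι) (x : ι) : projKernel ψ T x ∈ projRange ψ T := by
  have : projKernel ψ T x = ∑ j ∈ T, ψ j x • ψ j := by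
    ext y
    simp [projKernel]
  rw [this]
  exact Submodule.sum_mem _ fun j hj =>
    Submodule.smul_mem _ _ (Submodule.subset_span ⟨⟨j, hj⟩, rfl⟩)

namespace IsEigenbasis

theorem coeff_eq_zero (h : IsEigenbasis A ψ e) {T : Finset ι} {w : ι → ℝ} (hw : w ∈ projRange ψ T)
    {k : ι} (hk : k ∉ T) : ψ k ⬝ᵥ w = 0 := by
  refine Submodule.span_induction (p := fun w _ => ψ k ⬝ᵥ w = 0) ?_ (by simp) ?_ ?_ hw
  · rintro _ ⟨j, rfl⟩
    rw [h.orth, if_neg]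
    rintro rfl
    exact hk j.2
  · intro x y _ _ hx hy
    rw [dotProduct_add, hx, hy, add_zero]
  · intro c x _ hx
    rw [dotProduct_smul, hx, smul_zero]

theorem finrank_projRange (h : IsEigenbasis A ψ e) (T : Finset ι) :
    Module.finrank ℝ (projRange ψ T) = T.card := by
  have hli : LinearIndependent ℝ fun j : T => ψ j := by
    rw [Fintype.linearIndependent_iff]
    intro g hg j
    have h1 : ψ j ⬝ᵥ ∑ i : T, g i • ψ i = 0 := by rw [hg, dotProduct_zero]
    rw [dotProduct_sum] at h1
    simp only [dotProduct_smul, h.orth, smul_eq_mul] at h1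
    have h2 : ∀ i : T, g i * (if (j : ι) = i then 1 else 0) = if j = i then g i else 0 := by
      intro i
      by_cases hji : j = i
      · simp [hji]
      · rw [if_neg hji, if_neg (fun h' => hji (Subtype.ext h')), mul_zero]
    simp only [h2, Finset.sum_ite_eq, Finset.mem_univ, if_true] at h1
    exact h1
  rw [projRange, finrank_span_eq_card hli, Fintype.card_coe]

theorem sum_sq_eq (h : IsEigenbasis A ψ e) (w : ι → ℝ) :
    ∑ x, w x ^ 2 = ∑ j, (ψ j ⬝ᵥ w) ^ 2 := by
  have := h.parseval w w
  simp only [dotProduct] at this ⊢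
  simp only [pow_two, this]

theorem sum_sq_sub_le (h : IsEigenbasis A ψ e) (hA : A.IsHermitian) {T : Finset ι} {E ε : ℝ}
    (hT : ∀ j ∈ T, |e j - E| ≤ ε) {w : ι → ℝ} (hw : w ∈ projRange ψ T) :
    ∑ x, ((A *ᵥ w) x - E * w x) ^ 2 ≤ ε ^ 2 * ∑ x, w x ^ 2 := by
  rw [h.sum_sq_sub hA, h.sum_sq_eq, Finset.mul_sum]
  refine Finset.sum_le_sum fun j _ => ?_
  by_cases hj : j ∈ T
  · refine mul_le_mul_of_nonneg_right ?_ (sq_nonneg _)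
    rw [← sq_abs]
    exact pow_le_pow_left₀ (abs_nonneg _) (hT j hj) 2
  · simp [h.coeff_eq_zero hw hj]

/-- Cauchy–Schwarz in the eigenbasis: a small diagonal entry at y makes every vector of the range
small at y. -/
theorem sq_le_projKernel (h : IsEigenbasis A ψ e) {T : Finset ι} {w : ι → ℝ}
    (hw : w ∈ projRange ψ T) (y : ι) : w y ^ 2 ≤ projKernel ψ T y y * ∑ x, w x ^ 2 := by
  have h1 : w y = ∑ j ∈ T, ψ j y * (ψ j ⬝ᵥ w) := by
    rw [← h.expansion w y]
    refine (Finset.sum_subset (Finset.subset_univ T) fun j _ hj => ?_).symm.trans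
      (Finset.sum_congr rfl fun j _ => mul_comm _ _)
    rw [h.coeff_eq_zero hw hj, zero_mul]
  rw [h1]
  refine (Finset.sum_mul_sq_le_sq_mul_sq T _ _).trans ?_
  have h2 : projKernel ψ T y y = ∑ j ∈ T, ψ j y ^ 2 :=
    Finset.sum_congr rfl fun j _ => (pow_two _).symm
  rw [h2, h.sum_sq_eq]
  exact mul_le_mul_of_nonneg_left
    (Finset.sum_le_sum_of_subset_of_nonneg (Finset.subset_univ T) fun _ _ _ => sq_nonneg _)
    (Finset.sum_nonneg fun _ _ => sq_nonneg _)

theorem sum_projKernel (h : IsEigenbasis A ψ e) (T : Finset ι) :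
    ∑ x, projKernel ψ T x x = T.card := by
  simp only [projKernel]
  rw [Finset.sum_comm]
  have : ∀ j, ∑ x, ψ j x * ψ j x = 1 := fun j => h.dotProduct_self_eq_one j
  simp [this]

theorem projKernel_le_one (h : IsEigenbasis A ψ e) (T : Finset ι) (x : ι) :
    projKernel ψ T x x ≤ 1 := by
  have := h.complete x x
  rw [if_pos rfl] at this
  rw [← this]
  exact Finset.sum_le_sum_of_subset_of_nonneg (Finset.subset_univ T) fun _ _ _ => mul_self_nonneg _

/-- This is P² = P on the diagonal: a column of P has squared norm P(x,x). -/
theorem sum_projKernel_sq (h : IsEigenbasis A ψ e) (T : Finset ι) (x : ι) :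
    ∑ y, projKernel ψ T x y ^ 2 = projKernel ψ T x x := by
  have hc : ∀ j, ψ j ⬝ᵥ projKernel ψ T x = if j ∈ T then ψ j x else 0 := by
    intro j
    have h1 : projKernel ψ T x = ∑ k ∈ T, ψ k x • ψ k := by
      ext y
      simp [projKernel]
    rw [h1, dotProduct_sum]
    simp [dotProduct_smul, h.orth]
  rw [h.sum_sq_eq]
  simp only [hc, projKernel, ite_pow, ne_eq, OfNat.ofNat_ne_zero, not_false_eq_true, zero_pow]
  simp [pow_two]

end IsEigenbasis

theorem cfc_indicator_eq_projKernel (hA : A.IsHermitian) (B : Set ℝ) [DecidablePred (· ∈ B)]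
    (x y : ι) : cfc (B.indicator fun _ => (1 : ℝ)) A x y =
      projKernel (fun j x => hA.eigenvectorBasis j x)
        (Finset.univ.filter fun j => hA.eigenvalues j ∈ B) x y := by
  rw [hA.cfc_apply_eq_sum, projKernel, Finset.sum_filter]
  refine Finset.sum_congr rfl fun j _ => ?_
  rw [Set.indicator_apply]
  split_ifs <;> simp

end Kernel

/-! ### From eigenvalues of the box to separated short intervals -/

/-- `[1, L]` contains `N` intervals of length at most `R`, with pairwise distances at least `S`, on
each of which the Jacobi operator has an eigenvalue in `B`. -/
def HasSeparatedEigenvalues (a v : ℤ → ℝ) (L R S N : ℕ) (B : Set ℝ) : Prop :=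
  ∃ l r : Fin N → ℤ, (∀ k, 1 ≤ l k ∧ l k ≤ r k ∧ r k ≤ L ∧ r k ≤ l k + R) ∧
    (∀ k k', k ≠ k' → ∀ x ∈ Finset.Icc (l k) (r k), ∀ y ∈ Finset.Icc (l k') (r k'),
      (S : ℤ) ≤ |x - y|) ∧ ∀ k, HasEigenvalueIn (jacobiBox a v (l k) (r k)) B

theorem HasEigenvalueIn.mono {ι : Type*} [Fintype ι] {A : Matrix ι ι ℝ} {B C : Set ℝ}
    (h : HasEigenvalueIn A B) (hBC : B ⊆ C) : HasEigenvalueIn A C := by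
  obtain ⟨t, ht, w, hw⟩ := h
  exact ⟨t, hBC ht, w, hw⟩

section Localization

variable {a v : ℤ → ℝ} {K : ℝ} {L : ℕ} {E ε τ : ℝ}

theorem hasEigenvalueIn_of_card_pos {p q : ℤ}
    (h : 0 < (Finset.univ.filter fun j =>
      |(jacobiBox_isHermitian a v p q).eigenvalues j - E| ≤ ε).card) :
    HasEigenvalueIn (jacobiBox a v p q) (Set.Icc (E - ε) (E + ε)) := by
  obtain ⟨j, hj⟩ := Finset.card_pos.mp h
  have hj' := abs_le.mp (Finset.mem_filter.mp hj).2
  exact ((jacobiBox_isHermitian a v p q).isEigenbasis.hasEigenvalueIn_iff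
    (jacobiBox_isHermitian a v p q) _).mpr ⟨j, by linarith, by linarith⟩

/-- A site at which the spectral projection is not negligible is the centre of a short interval
with an eigenvalue nearby. -/
theorem hasEigenvalueIn_of_le_projKernel (ha : ∀ n, |a n| ≤ K) {ℓ : ℕ} (hε : 0 < ε) (hτ0 : 0 < τ)
    (hτ : 12 * (L : ℝ) * K ^ 2 * τ ≤ ε ^ 2) (hτ' : 4 * (L : ℝ) * τ ≤ 1)
    {ψ : Finset.Icc (1 : ℤ) L → Finset.Icc (1 : ℤ) L → ℝ} {e : Finset.Icc (1 : ℤ) L → ℝ}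
    (h : IsEigenbasis (jacobiBox a v 1 L) ψ e) {T : Finset (Finset.Icc (1 : ℤ) L)}
    (hT : ∀ j ∈ T, |e j - E| ≤ ε) {x : Finset.Icc (1 : ℤ) L} (hx : τ ≤ projKernel ψ T x x)
    (hP : ∀ y : Finset.Icc (1 : ℤ) L, (ℓ : ℤ) < |(y : ℤ) - x| → |projKernel ψ T x y| ≤ τ) :
    HasEigenvalueIn (jacobiBox a v (max 1 ((x : ℤ) - ℓ)) (min L ((x : ℤ) + ℓ)))
      (Set.Icc (E - 2 * ε) (E + 2 * ε)) := by
  have hcard : Fintype.card (Finset.Icc (1 : ℤ) L) = L := by simp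
  have hne : projKernel ψ T x ≠ 0 := by
    intro h0
    rw [h0, Pi.zero_apply] at hx
    linarith
  refine hasEigenvalueIn_of_card_pos (lt_of_lt_of_le ?_ (finrank_le_card_of_concentrated ha
    (le_max_left _ _) (min_le_left _ _) hε hτ0.le (by rw [hcard]; exact hτ)
    (by rw [hcard]; exact hτ') (Submodule.span ℝ {projKernel ψ T x}) ?_ ?_))
  · rw [finrank_span_singleton hne]
    exact one_pos
  · intro w hw
    exact h.sum_sq_sub_le (jacobiBox_isHermitian a v 1 L) hT
      (Submodule.span_le.mpr (Set.singleton_subset_iff.mpr (projKernel_mem T x)) hw)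
  · intro w hw y hy
    obtain ⟨c, rfl⟩ := Submodule.mem_span_singleton.mp hw
    simp only [Pi.smul_apply, smul_eq_mul, mul_pow]
    rw [← Finset.mul_sum, h.sum_projKernel_sq]
    have hy' := Finset.mem_Icc.mp y.2
    have h1 : |projKernel ψ T x y| ≤ τ := by
      refine hP y ?_
      simp only [Finset.mem_Icc] at hy
      rw [lt_abs]
      omega
    -- The hypothesis τ ≤ P(x,x) turns the absolute bound on the entry into one relative to the
    -- squared norm P(x,x) of the column.
    have h2 : projKernel ψ T x y ^ 2 ≤ τ * projKernel ψ T x x := by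
      rw [← sq_abs, pow_two]
      exact mul_le_mul h1 (h1.trans hx) (abs_nonneg _) hτ0.le
    have := mul_le_mul_of_nonneg_left h2 (sq_nonneg c)
    linarith

theorem hasSeparatedEigenvalues_of_points {D : ℝ} (hD : 2 * ε ≤ D) {ℓ S N : ℕ} (x : Fin N → ℤ)
    (hx1 : ∀ k, 1 ≤ x k ∧ x k ≤ L)
    (hx : ∀ k k', k ≠ k' → (2 * ℓ + S + 1 : ℤ) ≤ |x k - x k'|)
    (h : ∀ k, HasEigenvalueIn (jacobiBox a v (max 1 (x k - ℓ)) (min L (x k + ℓ)))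
      (Set.Icc (E - 2 * ε) (E + 2 * ε))) :
    HasSeparatedEigenvalues a v L (2 * ℓ + S) S N (Set.Icc (E - D) (E + D)) := by
  refine ⟨fun k => max 1 (x k - ℓ), fun k => min L (x k + ℓ), fun k => ?_, fun k k' hk y hy z hz =>
    ?_, fun k => (h k).mono (Set.Icc_subset_Icc (by linarith) (by linarith))⟩
  · have := hx1 k
    push_cast
    omega
  · have := hx k k' hk
    simp only [Finset.mem_Icc] at hy hz
    rw [le_abs] at this ⊢
    omega

variable {ℓ S : ℕ} {ψ : Finset.Icc (1 : ℤ) L → Finset.Icc (1 : ℤ) L → ℝ}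
  {e : Finset.Icc (1 : ℤ) L → ℝ} {T : Finset (Finset.Icc (1 : ℤ) L)}

/-- The trace is at most the number of sites with P(x,x) ≥ τ plus Lτ ≤ 1/4, and both counts are
integers. -/
theorem IsEigenbasis.card_le_card_filter (h : IsEigenbasis (jacobiBox a v 1 L) ψ e)
    (hτ0 : 0 < τ) (hτ' : 4 * (L : ℝ) * τ ≤ 1) (T : Finset (Finset.Icc (1 : ℤ) L)) :
    T.card ≤ (Finset.univ.filter fun x => τ ≤ projKernel ψ T x x).card := by
  have h1 : (T.card : ℝ) ≤ (Finset.univ.filter fun x => τ ≤ projKernel ψ T x x).card + L * τ := by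
    rw [← h.sum_projKernel T]
    calc ∑ x, projKernel ψ T x x ≤ ∑ x, ((if τ ≤ projKernel ψ T x x then 1 else 0) + τ) := by
          refine Finset.sum_le_sum fun x _ => ?_
          split_ifs with hx
          · linarith [h.projKernel_le_one T x]
          · linarith
      _ = _ := by
          rw [Finset.sum_add_distrib, Finset.sum_boole, Finset.sum_const]
          simp
  have h2 : (T.card : ℝ) < (Finset.univ.filter fun x => τ ≤ projKernel ψ T x x).card + 1 := by
    linarith
  have : T.card < (Finset.univ.filter fun x => τ ≤ projKernel ψ T x x).card + 1 := by
    exact_mod_cast h2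
  omega

/-- Many eigenvalues give many separated short intervals with an eigenvalue nearby. -/
theorem hasSeparatedEigenvalues_of_card_ge (ha : ∀ n, |a n| ≤ K) (hε : 0 < ε) (hτ0 : 0 < τ)
    (hτ : 12 * (L : ℝ) * K ^ 2 * τ ≤ ε ^ 2) (hτ' : 4 * (L : ℝ) * τ ≤ 1) {D : ℝ} (hD : 2 * ε ≤ D)
    (h : IsEigenbasis (jacobiBox a v 1 L) ψ e) (hT : ∀ j ∈ T, |e j - E| ≤ ε)
    (hP : ∀ x y : Finset.Icc (1 : ℤ) L, (ℓ : ℤ) < |(y : ℤ) - x| → |projKernel ψ T x y| ≤ τ)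
    {N : ℕ} (hN : N * (2 * ℓ + S + 1) ≤ T.card) :
    HasSeparatedEigenvalues a v L (2 * ℓ + S) S N (Set.Icc (E - D) (E + D)) := by
  set X := Finset.univ.filter fun x => τ ≤ projKernel ψ T x x with hX
  have hcard := hN.trans (h.card_le_card_filter hτ0 hτ' T)
  rw [← hX] at hcard
  -- Taking every (2ℓ+S+1)-th element of `X` in increasing order gives sites at distance at least
  -- 2ℓ+S+1.
  let f := X.orderEmbOfFin rfl
  have hidx : ∀ k : Fin N, (k : ℕ) * (2 * ℓ + S + 1) < X.card := by
    intro k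
    refine lt_of_lt_of_le ?_ hcard
    exact Nat.mul_lt_mul_of_pos_right k.2 (by omega)
  have hmono : ∀ (i : ℕ) (d : ℕ) (h1 : i < X.card) (h2 : i + d < X.card),
      ((f ⟨i, h1⟩ : Finset.Icc (1 : ℤ) L) : ℤ) + d ≤ (f ⟨i + d, h2⟩ : Finset.Icc (1 : ℤ) L) := by
    intro i d h1
    induction d with
    | zero => intro h2; simp
    | succ d ih =>
      intro h2
      have i1 := ih (by omega)
      have i2 : f ⟨i + d, by omega⟩ < f ⟨i + (d + 1), h2⟩ :=
        f.strictMono (by simp [Fin.lt_def])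
      have i3 : ((f ⟨i + d, by omega⟩ : Finset.Icc (1 : ℤ) L) : ℤ) <
        (f ⟨i + (d + 1), h2⟩ : Finset.Icc (1 : ℤ) L) := i2
      push_cast
      omega
  have hlt : ∀ k k' : Fin N, k < k' → ((f ⟨_, hidx k⟩ : Finset.Icc (1 : ℤ) L) : ℤ) +
      (2 * ℓ + S + 1 : ℕ) ≤ (f ⟨_, hidx k'⟩ : Finset.Icc (1 : ℤ) L) := by
    intro k k' hk
    have hle : (k : ℕ) * (2 * ℓ + S + 1) + (2 * ℓ + S + 1) ≤ (k' : ℕ) * (2 * ℓ + S + 1) := by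
      rw [← Nat.succ_mul]
      exact Nat.mul_le_mul_right _ hk
    obtain ⟨d, hd⟩ := Nat.exists_eq_add_of_le hle
    have h1 := hmono ((k : ℕ) * (2 * ℓ + S + 1)) (2 * ℓ + S + 1 + d) (hidx k)
      (by have := hidx k'; omega)
    have h2 : f ⟨(k : ℕ) * (2 * ℓ + S + 1) + (2 * ℓ + S + 1 + d), by have := hidx k'; omega⟩ =
        f ⟨_, hidx k'⟩ := congrArg f (Fin.ext (by simp only; omega))
    rw [h2] at h1
    push_cast at h1 ⊢
    omega
  refine hasSeparatedEigenvalues_of_points hD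
    (fun k : Fin N => ((f ⟨_, hidx k⟩ : Finset.Icc (1 : ℤ) L) : ℤ))
    (fun k => Finset.mem_Icc.mp (f ⟨_, hidx k⟩ : Finset.Icc (1 : ℤ) L).2) ?_ ?_
  · intro k k' hk
    rw [le_abs]
    rcases lt_or_gt_of_ne hk with hk | hk
    · have := hlt k k' hk
      push_cast at this
      right
      omega
    · have := hlt k' k hk
      push_cast at this
      left
      omega
  · intro k
    have hmem : f ⟨_, hidx k⟩ ∈ X := X.orderEmbOfFin_mem rfl _
    exact hasEigenvalueIn_of_le_projKernel ha hε hτ0 hτ hτ' h hT (Finset.mem_filter.mp hmem).2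
      (hP _)

/-- Two eigenvalues give two separated short intervals with an eigenvalue nearby. -/
theorem hasSeparatedEigenvalues_two {F : ℝ} (hK : 0 < K)
    (ha : ∀ n, 1 / K ≤ |a n| ∧ |a n| ≤ K ∧ |v n| ≤ K) (hS : 1 ≤ S) (hε : 0 < ε) (hτ0 : 0 < τ)
    (hτ : 12 * (L : ℝ) * K ^ 2 * τ ≤ ε ^ 2) (hτ' : 4 * (L : ℝ) * τ ≤ 1) {D : ℝ}
    (hD : 6 * (2 * ε) ≤ D) (hF : |E| + 2 * ε ≤ F)
    (hsmall : 4 * (S + 1) * (K * (F + 2 * K) + 1) ^ (2 * S + 2) *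
      (8 * (2 * ε) / D + S * (K * (2 * (2 * ε)))) ≤ 1)
    (h : IsEigenbasis (jacobiBox a v 1 L) ψ e) (hT : ∀ j ∈ T, |e j - E| ≤ ε)
    (hP : ∀ x y : Finset.Icc (1 : ℤ) L, (ℓ : ℤ) < |(y : ℤ) - x| → |projKernel ψ T x y| ≤ τ)
    (hcard : 2 ≤ T.card) :
    HasSeparatedEigenvalues a v L (2 * ℓ + S) S 2 (Set.Icc (E - D) (E + D)) := by
  set X := Finset.univ.filter fun x => τ ≤ projKernel ψ T x x with hX
  have haK : ∀ n, |a n| ≤ K := fun n => (ha n).2.1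
  by_cases hfar : ∃ x ∈ X, ∃ y ∈ X, (2 * ℓ + S + 1 : ℤ) ≤ |(x : ℤ) - y|
  · obtain ⟨x, hx, y, hy, hxy⟩ := hfar
    refine hasSeparatedEigenvalues_of_points (ε := ε) (by linarith) ![(x : ℤ), (y : ℤ)] ?_ ?_ ?_
    · exact Fin.forall_fin_two.mpr ⟨Finset.mem_Icc.mp x.2, Finset.mem_Icc.mp y.2⟩
    · rw [Fin.forall_fin_two]
      constructor <;> rw [Fin.forall_fin_two] <;> constructor <;> intro hne
      · exact absurd rfl hne
      · exact hxy
      · rw [abs_sub_comm]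
        exact hxy
      · exact absurd rfl hne
    · exact Fin.forall_fin_two.mpr
        ⟨hasEigenvalueIn_of_le_projKernel haK hε hτ0 hτ hτ' h hT (Finset.mem_filter.mp hx).2 (hP _),
          hasEigenvalueIn_of_le_projKernel haK hε hτ0 hτ hτ' h hT (Finset.mem_filter.mp hy).2 (hP _)⟩
  push Not at hfar
  have hXne : X.Nonempty := by
    rw [← Finset.card_pos]
    have := h.card_le_card_filter hτ0 hτ' T
    rw [← hX] at this
    omega
  set l := X.min' hXne with hl
  set r := X.max' hXne with hr
  have hlX : l ∈ X := X.min'_mem hXne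
  have hrX : r ∈ X := X.max'_mem hXne
  have hlr := (abs_lt.mp (hfar r hrX l hlX)).2
  have hl1 := Finset.mem_Icc.mp l.2
  have hr1 := Finset.mem_Icc.mp r.2
  have hLc : Fintype.card (Finset.Icc (1 : ℤ) L) = L := by simp
  -- Outside [l, r] the diagonal of P is below τ, so the whole range of P is concentrated there and
  -- the short box inherits both eigenvalues, now within 2ε.
  have hfin := finrank_le_card_of_concentrated (v := v) haK (p := 1) (q := L) (l := l) (r := r)
    hl1.1 hr1.2 hε hτ0.le (by rw [hLc]; exact hτ) (by rw [hLc]; exact hτ') (projRange ψ T)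
    (fun w hw => h.sum_sq_sub_le (jacobiBox_isHermitian a v 1 L) hT hw)
    (fun w hw y hy => by
      refine (h.sq_le_projKernel hw y).trans (mul_le_mul_of_nonneg_right ?_
        (Finset.sum_nonneg fun _ _ => sq_nonneg _))
      by_contra! hlt
      have hyX : y ∈ X := Finset.mem_filter.mpr ⟨Finset.mem_univ _, hlt.le⟩
      have h1 : l ≤ y := X.min'_le y hyX
      have h2 : y ≤ r := X.le_max' y hyX
      exact hy (Finset.mem_Icc.mpr ⟨h1, h2⟩))
  rw [h.finrank_projRange] at hfin
  obtain ⟨i, hi, j, hj, hij⟩ := Finset.one_lt_card.mp (lt_of_lt_of_le Nat.one_lt_two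
    (hcard.trans hfin))
  have hB := (jacobiBox_isHermitian a v l r).isEigenbasis
  have hi' := (Finset.mem_filter.mp hi).2
  have hj' := (Finset.mem_filter.mp hj).2
  have hFle : ∀ t : ℝ, |t - E| ≤ 2 * ε → |t| ≤ F := by
    intro t ht
    have : |t| ≤ |t - E| + |E| := by simpa using abs_add_le (t - E) E
    linarith
  obtain ⟨n, n', hnn, hL, hR⟩ := exists_two_hasEigenvalueIn hK ha hS (by positivity : 0 < 2 * ε) hD
    hi' hj' (hFle _ hi') (hFle _ hj') hsmall (hB.ne_zero i) (hB.ne_zero j) (hB.eig i) (hB.eig j)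
    (by rw [hB.orth, if_neg hij])
  have hln := le_of_hasEigenvalueIn_jacobiBox hL
  have hnr := le_of_hasEigenvalueIn_jacobiBox hR
  refine ⟨![(l : ℤ), n'], ![n, (r : ℤ)], ?_, ?_, Fin.forall_fin_two.mpr ⟨hL, hR⟩⟩
  · refine Fin.forall_fin_two.mpr ⟨?_, ?_⟩
    · change 1 ≤ (l : ℤ) ∧ (l : ℤ) ≤ n ∧ n ≤ L ∧ n ≤ l + (2 * ℓ + S : ℕ)
      push_cast
      omega
    · change 1 ≤ n' ∧ n' ≤ r ∧ (r : ℤ) ≤ L ∧ (r : ℤ) ≤ n' + (2 * ℓ + S : ℕ)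
      push_cast
      omega
  · rw [Fin.forall_fin_two]
    constructor <;> rw [Fin.forall_fin_two] <;> constructor <;> intro hne x hx y hy
    · exact absurd rfl hne
    · change x ∈ Finset.Icc (l : ℤ) n at hx
      change y ∈ Finset.Icc n' (r : ℤ) at hy
      rw [Finset.mem_Icc] at hx hy
      rw [le_abs]
      omega
    · change x ∈ Finset.Icc n' (r : ℤ) at hx
      change y ∈ Finset.Icc (l : ℤ) n at hy
      rw [Finset.mem_Icc] at hx hy
      rw [le_abs]
      omega
    · exact absurd rfl hne

end Localization

/-! ### Measurability of spectral events and projections -/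

section Measurability

theorem hasEigenvalueIn_iff_det {ι : Type*} [Fintype ι] [DecidableEq ι] (A : Matrix ι ι ℝ)
    (B : Set ℝ) : HasEigenvalueIn A B ↔ ∃ t ∈ B, (A - t • (1 : Matrix ι ι ℝ)).det = 0 := by
  refine exists_congr fun t => and_congr_right fun _ => ?_
  rw [← Matrix.exists_mulVec_eq_zero_iff]
  refine exists_congr fun w => and_congr_right fun _ => ?_
  rw [Matrix.sub_mulVec, Matrix.smul_mulVec, Matrix.one_mulVec, sub_eq_zero]

/-- The set is the projection, along the compact factor `B`, of the closed zero set of det(M − t).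
-/
theorem isClosed_hasEigenvalueIn {ι : Type*} [Fintype ι] [DecidableEq ι] {B : Set ℝ}
    (hB : IsCompact B) : IsClosed {M : ι → ι → ℝ | HasEigenvalueIn (Matrix.of M) B} := by
  have := isCompact_iff_compactSpace.mp hB
  have hcl : IsClosed {x : B × (ι → ι → ℝ) |
      (Matrix.of x.2 - (x.1 : ℝ) • (1 : Matrix ι ι ℝ)).det = 0} := by
    refine isClosed_eq (Continuous.matrix_det ?_) continuous_const
    refine Continuous.sub ?_ (Continuous.smul (continuous_subtype_val.comp continuous_fst) continuous_const)
    exact continuous_snd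
  have himage : {M : ι → ι → ℝ | HasEigenvalueIn (Matrix.of M) B} =
      Prod.snd '' {x : B × (ι → ι → ℝ) |
        (Matrix.of x.2 - (x.1 : ℝ) • (1 : Matrix ι ι ℝ)).det = 0} := by
    ext M
    simp only [Set.mem_ofPred_eq, hasEigenvalueIn_iff_det, Set.mem_image, Prod.exists,
      exists_eq_right, Subtype.exists, exists_prop]
  rw [himage]
  exact isClosedMap_snd_of_compactSpace _ hcl

open Polynomial in
-- The powers (1 + dist(t,B))^{−n} decrease to the indicator of a closed set; Weierstrass on [−n, n]
-- replaces them by polynomials.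
theorem exists_polynomial_tendsto_indicator {B : Set ℝ} (hB : IsClosed B) (hne : B.Nonempty) :
    ∃ p : ℕ → ℝ[X], ∀ t, Filter.Tendsto (fun n => (p n).eval t) Filter.atTop
      (nhds (B.indicator (fun _ => (1 : ℝ)) t)) := by
  set f : ℕ → ℝ → ℝ := fun n t => ((1 + Metric.infDist t B)⁻¹) ^ n with hf
  have hfc : ∀ n, Continuous (f n) := by
    intro n
    refine Continuous.pow (Continuous.inv₀ (by fun_prop) fun t => ?_) n
    have : 0 ≤ Metric.infDist t B := Metric.infDist_nonneg
    positivity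
  have hlim : ∀ t, Filter.Tendsto (fun n => f n t) Filter.atTop
      (nhds (B.indicator (fun _ => (1 : ℝ)) t)) := by
    intro t
    by_cases ht : t ∈ B
    · simp [hf, ht, Metric.infDist_zero_of_mem ht]
    · rw [Set.indicator_of_notMem ht]
      have hpos := (hB.notMem_iff_infDist_pos hne).mp ht
      exact tendsto_pow_atTop_nhds_zero_of_lt_one (by positivity)
        (inv_lt_one_of_one_lt₀ (by linarith))
  have hp : ∀ n : ℕ, ∃ p : ℝ[X], ∀ x ∈ Set.Icc (-(n : ℝ)) n, |p.eval x - f n x| < 1 / ((n : ℝ) + 1) :=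
    fun n => exists_polynomial_near_of_continuousOn _ _ _ (hfc n).continuousOn _ (by positivity)
  choose p hp using hp
  refine ⟨p, fun t => ?_⟩
  have hdiff : Filter.Tendsto (fun n => (p n).eval t - f n t) Filter.atTop (nhds 0) := by
    refine squeeze_zero_norm' ?_ tendsto_one_div_add_atTop_nhds_zero_nat
    obtain ⟨m, hm⟩ := exists_nat_ge |t|
    filter_upwards [Filter.eventually_ge_atTop m] with n hn
    have : |t| ≤ n := hm.trans (by exact_mod_cast hn)
    exact (hp n t (abs_le.mp this)).le
  simpa using hdiff.add (hlim t)

/-- Polynomials in A have measurable entries and converge entrywise to the spectral projection, so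
no measurable choice of eigenvectors is needed. -/
theorem measurable_cfc_indicator {Ω : Type*} [MeasurableSpace Ω] {ι : Type*} [Fintype ι]
    [DecidableEq ι] {A : Ω → Matrix ι ι ℝ} (hA : ∀ ω, (A ω).IsHermitian)
    (hm : ∀ x y, Measurable fun ω => A ω x y) {B : Set ℝ} (hB : IsClosed B) (hne : B.Nonempty)
    (x y : ι) : Measurable fun ω => cfc (B.indicator fun _ => (1 : ℝ)) (A ω) x y := by
  obtain ⟨p, hp⟩ := exists_polynomial_tendsto_indicator hB hne
  have hpow : ∀ (k : ℕ) x y, Measurable fun ω => (A ω ^ k) x y := by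
    intro k
    induction k with
    | zero => intro x y; simp
    | succ k ih =>
      intro x y
      simp only [pow_succ, Matrix.mul_apply]
      exact Finset.measurable_fun_sum _ fun z _ => (ih x z).mul (hm z y)
  refine measurable_of_tendsto_metrizable (f := fun n ω => (Polynomial.aeval (A ω) (p n)) x y)
    (fun n => ?_) ?_
  · simp only [Polynomial.aeval_eq_sum_range, Matrix.sum_apply, Matrix.smul_apply, smul_eq_mul]
    exact Finset.measurable_fun_sum _ fun k _ => (hpow k x y).const_mul _
  · rw [tendsto_pi_nhds]
    intro ω
    have h : ∀ n, (Polynomial.aeval (A ω) (p n)) x y =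
        ∑ j, (p n).eval ((hA ω).eigenvalues j) *
          ((hA ω).eigenvectorBasis j x * (hA ω).eigenvectorBasis j y) := by
      intro n
      rw [← cfc_polynomial (p n) (A ω) (hA ω).isSelfAdjoint, (hA ω).cfc_apply_eq_sum]
    simp only [h]
    rw [(hA ω).cfc_apply_eq_sum]
    exact tendsto_finsetSum _ fun j _ => (hp _).mul_const _

variable {Ω : Type*} [MeasurableSpace Ω] {a V : ℤ → Ω → ℝ}

/-- The coefficient a(m) sits on the bond leaving the box at the left, so only a(m+1), …, a(n)
enter. This is what makes disjoint boxes independent in the hopping model. -/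
theorem measurable_randomJacobi_apply {m n : ℤ} (ha : ∀ k ∈ Set.Icc (m + 1) n, Measurable (a k))
    (hV : ∀ k, Measurable (V k)) (i j : Finset.Icc m n) :
    Measurable fun ω => randomJacobi a V m n ω i j := by
  have hi := Finset.mem_Icc.mp i.2
  have hj := Finset.mem_Icc.mp j.2
  simp only [randomJacobi, jacobiBox, Matrix.of_apply]
  split_ifs
  · exact ha _ ⟨by omega, by omega⟩
  · exact ha _ ⟨by omega, by omega⟩
  · exact hV _
  · exact measurable_const

theorem measurable_randomJacobi {m n : ℤ} (ha : ∀ k ∈ Set.Icc (m + 1) n, Measurable (a k))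
    (hV : ∀ k, Measurable (V k)) :
    Measurable fun ω => fun i j : Finset.Icc m n => randomJacobi a V m n ω i j :=
  measurable_pi_lambda _ fun i => measurable_pi_lambda _ fun j =>
    measurable_randomJacobi_apply ha hV i j

end Measurability

/-! ### Independence, Wegner's estimate and Markov's inequality -/

section Independence

variable {Ω : Type*} [MeasurableSpace Ω] {μ : Measure Ω} {a V : ℤ → Ω → ℝ}

/-- The events that the restrictions to intervals at distance at least `S` have an eigenvalue in a
given compact interval are independent. -/
def IndependentEigenvalues (μ : Measure Ω) (a V : ℤ → Ω → ℝ) (S : ℕ) : Prop :=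
  ∀ (N : ℕ) (l r : Fin N → ℤ) (c d : ℝ), (∀ k, l k ≤ r k) →
    (∀ k k', k ≠ k' → ∀ x ∈ Finset.Icc (l k) (r k), ∀ y ∈ Finset.Icc (l k') (r k'),
      (S : ℤ) ≤ |x - y|) →
    μ (⋂ k, {ω | HasEigenvalueIn (randomJacobi a V (l k) (r k) ω) (Set.Icc c d)}) =
      ∏ k, μ {ω | HasEigenvalueIn (randomJacobi a V (l k) (r k) ω) (Set.Icc c d)}

theorem IndependentAtDistance.independentEigenvalues (h : IndependentAtDistance μ a V) :
    ∃ S : ℕ, 1 ≤ S ∧ IndependentEigenvalues μ a V S := by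
  obtain ⟨S, hS⟩ := h
  -- Inverse tunneling needs a gap parameter of at least 1; enlarging `S` only weakens the
  -- statement.
  refine ⟨max S 1, le_max_right _ _, fun N l r c d hlr hdist => ?_⟩
  have hind := hS N l r hlr fun k k' hk x hx y hy => by
    have := hdist k k' hk x hx y hy
    push_cast at this
    omega
  have := hind.measure_inter_preimage_eq_mul Finset.univ
    (sets := fun k => {M | HasEigenvalueIn (Matrix.of M) (Set.Icc c d)})
    fun k _ => (isClosed_hasEigenvalueIn isCompact_Icc).measurableSet
  simp only [Finset.mem_univ, Set.iInter_true] at this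
  exact this

theorem measure_iInter_eq_prod_of_disjoint {ι κ : Type*} {m : ι → MeasurableSpace Ω}
    (hm : ∀ i, m i ≤ ‹MeasurableSpace Ω›) [IsProbabilityMeasure μ] (hind : iIndep m μ)
    (S : κ → Set ι)
    (hS : ∀ k k', k ≠ k' → Disjoint (S k) (S k')) (F : κ → Set Ω)
    (hF : ∀ k, MeasurableSet[⨆ i ∈ S k, m i] (F k)) (s : Finset κ) :
    μ (⋂ k ∈ s, F k) = ∏ k ∈ s, μ (F k) := by
  classical
  induction s using Finset.induction_on with
  | empty => simp
  | insert j s hj ih =>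
    rw [Finset.prod_insert hj, ← ih, Finset.set_biInter_insert]
    have hdisj : Disjoint (S j) (⋃ k ∈ s, S k) := by
      simp only [Set.disjoint_iUnion_right]
      intro k hk
      exact hS j k fun h => hj (h ▸ hk)
    refine (Indep_iff _ _ _).mp (indep_iSup_of_disjoint hm hind hdisj) _ _ (hF j) ?_
    refine MeasurableSet.biInter s.countable_toSet fun k hk => ?_
    exact (biSup_mono fun i hi => Set.mem_biUnion hk hi : ⨆ i ∈ S k, m i ≤ _) _ (hF k)

/-- Distance 1 already means disjoint boxes, whose inner bonds are then disjoint. -/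
theorem IsRandomHopping.independentEigenvalues [IsProbabilityMeasure μ]
    (ha : ∀ n, Measurable (a n)) (h : IsRandomHopping μ a V) : IndependentEigenvalues μ a V 1 := by
  obtain ⟨hV, hind, -⟩ := h
  intro N l r c d hlr hdist
  have hdisj : ∀ k k', k ≠ k' → Disjoint (Set.Icc (l k + 1) (r k)) (Set.Icc (l k' + 1) (r k')) := by
    intro k k' hk
    rw [Set.disjoint_left]
    rintro x ⟨h1, h2⟩ ⟨h3, h4⟩
    have := hdist k k' hk x (by simp only [Finset.mem_Icc]; omega) x
      (by simp only [Finset.mem_Icc]; omega)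
    simp at this
  have := measure_iInter_eq_prod_of_disjoint (fun i => (ha i).comap_le) hind.iIndep
    (fun k => Set.Icc (l k + 1) (r k)) hdisj
    (fun k => {ω | HasEigenvalueIn (randomJacobi a V (l k) (r k) ω) (Set.Icc c d)})
    (fun k => by
      -- Measurability is taken with respect to the σ-algebra generated by the inner bonds of the
      -- box alone.
      have hmeas := @measurable_randomJacobi Ω
        (⨆ i ∈ Set.Icc (l k + 1) (r k), MeasurableSpace.comap (a i) inferInstance) a V (l k) (r k)
        (fun n hn => Measurable.mono (comap_measurable (a n))
          (le_biSup (fun i => MeasurableSpace.comap (a i) inferInstance) hn) le_rfl)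
        (fun n => by
          rw [show V n = fun _ => 0 from funext (hV n)]
          exact measurable_const)
      exact hmeas (isClosed_hasEigenvalueIn isCompact_Icc).measurableSet) Finset.univ
  simpa using this

/-- Wegner's estimate and independence bound the probability of many separated eigenvalues. -/
theorem measure_hasSeparatedEigenvalues_le {S : ℕ} (hind : IndependentEigenvalues μ a V S)
    {C r s : ℝ} (hC : 0 < C) (hr : 1 ≤ r) {I : Set ℝ}
    (hW : ∀ m n : ℤ, 0 ≤ m → m ≤ n → ∀ x y : ℝ, x ≤ y → Set.Icc x y ⊆ I →
      μ {ω | 1 ≤ traceSpectralProj (randomJacobi a V m n ω) (Set.Icc x y)} ≤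
        ENNReal.ofReal (C * (y - x) ^ s * ((n - m + 1 : ℤ) : ℝ) ^ r))
    {E D : ℝ} (hD : 0 ≤ D) (hI : Set.Icc (E - D) (E + D) ⊆ I) (L R N : ℕ) :
    μ {ω | HasSeparatedEigenvalues (fun i => a i ω) (fun i => V i ω) L R S N
        (Set.Icc (E - D) (E + D))} ≤
      ENNReal.ofReal ((L * (R + 1) * (C * (2 * D) ^ s * (R + 1) ^ r)) ^ N) := by
  set J := Set.Icc (E - D) (E + D) with hJ
  set b := C * (2 * D) ^ s * ((R : ℝ) + 1) ^ r with hb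
  have hb0 : 0 ≤ b := by positivity
  -- Left ends and lengths are fixed in advance, giving (L(R+1))^N configurations. Configurations
  -- that violate the separation contribute the empty event.
  let Φ : (Fin N → Finset.Icc (1 : ℤ) L × Fin (R + 1)) → Set Ω := fun f =>
    {ω | (∀ k k', k ≠ k' → ∀ x ∈ Finset.Icc ((f k).1 : ℤ) ((f k).1 + (f k).2 : ℤ),
        ∀ y ∈ Finset.Icc ((f k').1 : ℤ) ((f k').1 + (f k').2 : ℤ), (S : ℤ) ≤ |x - y|) ∧
      ∀ k, HasEigenvalueIn (randomJacobi a V (f k).1 ((f k).1 + (f k).2 : ℤ) ω) J}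
  have hsub : {ω | HasSeparatedEigenvalues (fun i => a i ω) (fun i => V i ω) L R S N J} ⊆
      ⋃ f, Φ f := by
    rintro ω ⟨l, r, h1, h2, h3⟩
    have hr' : ∀ k, l k + (((r k - l k).toNat : ℕ) : ℤ) = r k := fun k => by
      have := h1 k
      omega
    refine Set.mem_iUnion.mpr ⟨fun k => (⟨l k, Finset.mem_Icc.mpr ?_⟩,
      ⟨(r k - l k).toNat, ?_⟩), ?_, ?_⟩
    · have := h1 k
      omega
    · have := h1 k
      omega
    · intro k k' hk
      simp only [hr']
      exact h2 k k' hk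
    · intro k
      change HasEigenvalueIn (jacobiBox (fun i => a i ω) (fun i => V i ω) (l k)
        (l k + (((r k - l k).toNat : ℕ) : ℤ))) J
      rw [hr' k]
      exact h3 k
  have hΦ : ∀ f, μ (Φ f) ≤ ENNReal.ofReal (b ^ N) := by
    intro f
    by_cases hf : ∀ k k', k ≠ k' → ∀ x ∈ Finset.Icc ((f k).1 : ℤ) ((f k).1 + (f k).2 : ℤ),
        ∀ y ∈ Finset.Icc ((f k').1 : ℤ) ((f k').1 + (f k').2 : ℤ), (S : ℤ) ≤ |x - y|
    · have hEq : Φ f = ⋂ k, {ω | HasEigenvalueIn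
          (randomJacobi a V (f k).1 ((f k).1 + (f k).2 : ℤ) ω) J} := by
        ext ω
        simp only [Φ, Set.mem_ofPred_eq, Set.mem_iInter]
        exact and_iff_right hf
      rw [hEq, hJ, hind N (fun k => (f k).1) (fun k => (f k).1 + (f k).2) _ _
        (fun k => by omega) hf]
      calc _ ≤ ∏ _k : Fin N, ENNReal.ofReal b := by
            refine Finset.prod_le_prod' fun k _ => ?_
            have h1 := Finset.mem_Icc.mp (f k).1.2
            have hle := hW (f k).1 ((f k).1 + (f k).2) (by omega) (by omega) (E - D) (E + D)
              (by linarith) hI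
            have hset : {ω | HasEigenvalueIn (randomJacobi a V (f k).1
                ((f k).1 + (f k).2 : ℤ) ω) (Set.Icc (E - D) (E + D))} =
                {ω | 1 ≤ traceSpectralProj (randomJacobi a V (f k).1
                  ((f k).1 + (f k).2 : ℤ) ω) (Set.Icc (E - D) (E + D))} := by
              ext ω
              exact (one_le_traceSpectralProj_iff (jacobiBox_isHermitian _ _ _ _) _).symm
            rw [hset]
            refine hle.trans (ENNReal.ofReal_le_ofReal ?_)
            rw [hb, show E + D - (E - D) = 2 * D by ring]
            refine mul_le_mul_of_nonneg_left ?_ (by positivity)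
            have h2 : (((f k).2 : ℕ) : ℝ) ≤ R := by exact_mod_cast Nat.lt_succ_iff.mp (f k).2.2
            refine Real.rpow_le_rpow ?_ ?_ (by linarith)
            · push_cast
              linarith [(Nat.cast_nonneg ((f k).2 : ℕ) : (0 : ℝ) ≤ _)]
            · push_cast
              linarith
        _ = _ := by rw [Finset.prod_const, ENNReal.ofReal_pow hb0]; simp
    · have : Φ f = ∅ := by
        ext ω
        simp only [Φ, Set.mem_ofPred_eq, Set.mem_empty_iff_false, iff_false]
        exact fun h => hf h.1
      rw [this]
      simp
  calc _ ≤ μ (⋃ f, Φ f) := measure_mono hsub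
    _ ≤ ∑ f, μ (Φ f) := measure_iUnion_fintype_le _ _
    _ ≤ ∑ _f : Fin N → Finset.Icc (1 : ℤ) L × Fin (R + 1), ENNReal.ofReal (b ^ N) :=
        Finset.sum_le_sum fun f _ => hΦ f
    _ = _ := by
        rw [Finset.sum_const, nsmul_eq_mul, mul_pow _ b N, ENNReal.ofReal_mul (by positivity)]
        congr 1
        rw [← ENNReal.ofReal_natCast]
        congr 1
        simp

/-- Markov's inequality for the kernel of the spectral projection, from localization. -/
theorem measure_exists_lt_cfc_le [IsProbabilityMeasure μ] (ha : ∀ n, Measurable (a n))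
    (hV : ∀ n, Measurable (V n)) {I : Set ℝ} {ξ C : ℝ} (hξ : 0 < ξ)
    (hLoc : ∀ (L : ℕ) (x : Finset.Icc (1 : ℤ) L) (f : ℝ → ℝ),
      Measurable f → (∀ t, |f t| ≤ 1) → tsupport f ⊆ I →
      ∫⁻ ω, ENNReal.ofReal (∑ y : Finset.Icc (1 : ℤ) L,
        Real.exp (|((y : ℤ) : ℝ) - ((x : ℤ) : ℝ)| ^ ξ) * |cfc f (randomJacobi a V 1 L ω) x y|) ∂μ
      ≤ ENNReal.ofReal C)
    {B : Set ℝ} (hB : IsClosed B) (hne : B.Nonempty) (hBI : B ⊆ I) (L ℓ : ℕ) {τ : ℝ}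
    (hτ : 0 < τ) :
    μ {ω | ∃ x y : Finset.Icc (1 : ℤ) L, (ℓ : ℤ) < |(y : ℤ) - x| ∧
        τ < |cfc (B.indicator fun _ => (1 : ℝ)) (randomJacobi a V 1 L ω) x y|} ≤
      L * (ENNReal.ofReal C / ENNReal.ofReal (Real.exp ((ℓ : ℝ) ^ ξ) * τ)) := by
  set f : ℝ → ℝ := B.indicator fun _ => (1 : ℝ) with hf
  let g : Finset.Icc (1 : ℤ) L → Ω → ℝ := fun x ω => ∑ y : Finset.Icc (1 : ℤ) L,
    Real.exp (|((y : ℤ) : ℝ) - ((x : ℤ) : ℝ)| ^ ξ) * |cfc f (randomJacobi a V 1 L ω) x y|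
  have hg : ∀ x, Measurable (g x) := fun x => Finset.measurable_fun_sum _ fun y _ =>
    ((measurable_cfc_indicator (fun ω => jacobiBox_isHermitian _ _ _ _)
      (measurable_randomJacobi_apply (fun k _ => ha k) hV) hB hne x y).abs).const_mul _
  set c := Real.exp ((ℓ : ℝ) ^ ξ) * τ with hc
  have hc0 : 0 < c := by positivity
  have hsub : {ω | ∃ x y : Finset.Icc (1 : ℤ) L, (ℓ : ℤ) < |(y : ℤ) - x| ∧
      τ < |cfc f (randomJacobi a V 1 L ω) x y|} ⊆
        ⋃ x, {ω | ENNReal.ofReal c ≤ ENNReal.ofReal (g x ω)} := by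
    rintro ω ⟨x, y, hxy, hlt⟩
    refine Set.mem_iUnion.mpr ⟨x, ENNReal.ofReal_le_ofReal ?_⟩
    refine le_trans ?_ (Finset.single_le_sum (f := fun y : Finset.Icc (1 : ℤ) L =>
      Real.exp (|((y : ℤ) : ℝ) - ((x : ℤ) : ℝ)| ^ ξ) * |cfc f (randomJacobi a V 1 L ω) x y|)
      (fun y _ => by positivity) (Finset.mem_univ y))
    have h1 : (ℓ : ℝ) ≤ |((y : ℤ) : ℝ) - ((x : ℤ) : ℝ)| := by
      have : ((ℓ : ℤ) : ℝ) ≤ ((|(y : ℤ) - x| : ℤ) : ℝ) := by exact_mod_cast hxy.le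
      push_cast at this
      exact this
    exact mul_le_mul (Real.exp_le_exp.mpr (Real.rpow_le_rpow (by positivity) h1 hξ.le)) hlt.le hτ.le
      (by positivity)
  have htsupp : tsupport f ⊆ I :=
    (closure_minimal (Function.support_subset_iff'.mpr fun t ht =>
      Set.indicator_of_notMem ht _) hB).trans hBI
  have hfb : ∀ t, |f t| ≤ 1 := by
    intro t
    by_cases ht : t ∈ B <;> simp [hf, ht]
  calc _ ≤ μ (⋃ x, {ω | ENNReal.ofReal c ≤ ENNReal.ofReal (g x ω)}) := measure_mono hsub
    _ ≤ ∑ x, μ {ω | ENNReal.ofReal c ≤ ENNReal.ofReal (g x ω)} := measure_iUnion_fintype_le _ _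
    _ ≤ ∑ _x : Finset.Icc (1 : ℤ) L, ENNReal.ofReal C / ENNReal.ofReal c := by
        refine Finset.sum_le_sum fun x _ => ?_
        refine (meas_ge_le_lintegral_div (hg x).ennreal_ofReal.aemeasurable
          (ENNReal.ofReal_pos.mpr hc0).ne' ENNReal.ofReal_ne_top).trans ?_
        gcongr
        exact hLoc L x f (measurable_const.indicator hB.measurableSet) hfb htsupp
    _ = _ := by
        rw [Finset.sum_const, nsmul_eq_mul]
        simp

end Independence

/-! ### Summation over the number of eigenvalues -/

section Counting

variable {Ω : Type*} [MeasurableSpace Ω] {μ : Measure Ω} {a V : ℤ → Ω → ℝ}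

theorem tsum_subtype_le_of_bounds (f : ℕ → ENNReal) {p L : ℕ} {x y : ENNReal}
    (h₂ : ∀ k, 2 ≤ k → f k ≤ x) (hp : ∀ k, p ≤ k → f k ≤ y) (hL : ∀ k, L < k → f k = 0) :
    ∑' k : {k : ℕ // 2 ≤ k}, f k ≤ p * x + (L + 1) * y := by
  have hle : ∀ k : {k : ℕ // 2 ≤ k}, f k ≤
      (if (k : ℕ) ∈ Finset.range p then x else 0) +
        (if (k : ℕ) ∈ Finset.range (L + 1) then y else 0) := by
    intro k
    simp only [Finset.mem_range]
    split_ifs with h1 h2 h2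
    · exact (h₂ k k.2).trans (le_add_of_nonneg_right zero_le)
    · exact (h₂ k k.2).trans (le_add_of_nonneg_right zero_le)
    · exact (hp k (by omega)).trans (by simp)
    · rw [hL k (by omega)]
      simp
  calc _ ≤ ∑' k : {k : ℕ // 2 ≤ k}, ((if (k : ℕ) ∈ Finset.range p then x else 0) +
        (if (k : ℕ) ∈ Finset.range (L + 1) then y else 0)) := ENNReal.tsum_le_tsum hle
    _ ≤ ∑' k : ℕ, ((if k ∈ Finset.range p then x else 0) +
        (if k ∈ Finset.range (L + 1) then y else 0)) :=
        ENNReal.tsum_comp_le_tsum_of_injective Subtype.val_injective _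
    _ = _ := by
        rw [ENNReal.tsum_add, tsum_eq_sum (s := Finset.range p) (fun k hk => if_neg hk),
          tsum_eq_sum (s := Finset.range (L + 1)) (fun k hk => if_neg hk),
          Finset.sum_congr rfl (fun k hk => if_pos hk),
          Finset.sum_congr rfl (fun k hk => if_pos hk)]
        simp

/-- Off the event that P has a large entry far from the diagonal, k ≥ 2 eigenvalues force two
separated intervals and k ≥ N(2ℓ+S+1) force N of them. -/
theorem tsum_measure_traceSpectralProj_le {K : ℝ} (hK : 0 < K)
    (hbdd : ∀ᵐ ω ∂μ, ∀ n : ℤ, 1 / K ≤ |a n ω| ∧ |a n ω| ≤ K ∧ |V n ω| ≤ K)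
    {S ℓ L N : ℕ} (hS : 1 ≤ S) {E ε τ D F : ℝ} (hε : 0 < ε) (hτ0 : 0 < τ)
    (hτ : 12 * (L : ℝ) * K ^ 2 * τ ≤ ε ^ 2) (hτ' : 4 * (L : ℝ) * τ ≤ 1)
    (hD : 6 * (2 * ε) ≤ D) (hF : |E| + 2 * ε ≤ F)
    (hsmall : 4 * (S + 1) * (K * (F + 2 * K) + 1) ^ (2 * S + 2) *
      (8 * (2 * ε) / D + S * (K * (2 * (2 * ε)))) ≤ 1)
    {β g₂ g : ENNReal}
    (hβ : μ {ω | ∃ x y : Finset.Icc (1 : ℤ) L, (ℓ : ℤ) < |(y : ℤ) - x| ∧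
      τ < |cfc ((Set.Icc (E - ε) (E + ε)).indicator fun _ => (1 : ℝ))
        (randomJacobi a V 1 L ω) x y|} ≤ β)
    (hg₂ : μ {ω | HasSeparatedEigenvalues (fun i => a i ω) (fun i => V i ω) L (2 * ℓ + S) S 2
      (Set.Icc (E - D) (E + D))} ≤ g₂)
    (hg : μ {ω | HasSeparatedEigenvalues (fun i => a i ω) (fun i => V i ω) L (2 * ℓ + S) S N
      (Set.Icc (E - D) (E + D))} ≤ g) :
    ∑' k : {k : ℕ // 2 ≤ k}, μ {ω | ((k : ℕ) : ℝ) ≤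
        traceSpectralProj (randomJacobi a V 1 L ω) (Set.Icc (E - ε) (E + ε))} ≤
      (N * (2 * ℓ + S + 1) : ℕ) * (β + g₂) + (L + 1) * (β + g) := by
  classical
  set B := Set.Icc (E - ε) (E + ε) with hB
  have hH : ∀ ω, (randomJacobi a V 1 L ω).IsHermitian := fun ω => jacobiBox_isHermitian _ _ _ _
  let T : Ω → Finset (Finset.Icc (1 : ℤ) L) := fun ω =>
    Finset.univ.filter fun j => (hH ω).eigenvalues j ∈ B
  have htr : ∀ (k : ℕ) ω, (k : ℝ) ≤ traceSpectralProj (randomJacobi a V 1 L ω) B →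
      k ≤ (T ω).card := by
    intro k ω h
    rw [traceSpectralProj_eq (hH ω)] at h
    exact_mod_cast h
  have hT : ∀ ω, ∀ j ∈ T ω, |(hH ω).eigenvalues j - E| ≤ ε := by
    intro ω j hj
    have := (Finset.mem_filter.mp hj).2
    exact abs_le.mpr ⟨by linarith [this.1], by linarith [this.2]⟩
  set bad : Set Ω := {ω | ∃ x y : Finset.Icc (1 : ℤ) L, (ℓ : ℤ) < |(y : ℤ) - x| ∧
      τ < |cfc (B.indicator fun _ => (1 : ℝ)) (randomJacobi a V 1 L ω) x y|} with hbad
  have hP : ∀ ω ∉ bad, ∀ x y : Finset.Icc (1 : ℤ) L, (ℓ : ℤ) < |(y : ℤ) - x| →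
      |projKernel (fun j x => (hH ω).eigenvectorBasis j x) (T ω) x y| ≤ τ := by
    intro ω hω x y hxy
    by_contra! hlt
    refine hω ⟨x, y, hxy, ?_⟩
    rwa [cfc_indicator_eq_projKernel (hH ω)]
  refine tsum_subtype_le_of_bounds (fun k => μ {ω | (k : ℝ) ≤
        traceSpectralProj (randomJacobi a V 1 L ω) B}) (fun k hk => ?_) (fun k hk => ?_)
        (fun k hk => ?_)
  · refine le_trans (measure_mono_ae ?_) ((measure_union_le bad _).trans (add_le_add hβ hg₂))
    filter_upwards [hbdd] with ω hω
    intro (hk' : (k : ℝ) ≤ _)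
    by_cases hb : ω ∈ bad
    · exact Or.inl hb
    · exact Or.inr (hasSeparatedEigenvalues_two hK hω hS hε hτ0 hτ hτ' hD hF hsmall
        (hH ω).isEigenbasis (hT ω) (hP ω hb) (hk.trans (htr k ω hk')))
  · refine le_trans (measure_mono_ae ?_) ((measure_union_le bad _).trans (add_le_add hβ hg))
    filter_upwards [hbdd] with ω hω
    intro (hk' : (k : ℝ) ≤ _)
    by_cases hb : ω ∈ bad
    · exact Or.inl hb
    · exact Or.inr (hasSeparatedEigenvalues_of_card_ge (fun n => (hω n).2.1) hε hτ0 hτ hτ'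
        (by linarith) (hH ω).isEigenbasis (hT ω) (hP ω hb) (hk.trans (htr k ω hk')))
  · have : {ω | (k : ℝ) ≤ traceSpectralProj (randomJacobi a V 1 L ω) B} = ∅ := by
      refine Set.eq_empty_iff_forall_notMem.mpr fun ω hω => ?_
      have h1 := htr k ω hω
      have h2 : (T ω).card ≤ L := by
        have := Finset.card_le_univ (T ω)
        simpa using this
      omega
    rw [this, measure_empty]

end Counting

/-! ### Powers of L -/

section Numerics

open Filter

theorem eventually_mul_rpow_mul_exp_le {κ : ℝ} (hκ : 0 < κ) (C A : ℝ) :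
    ∀ᶠ x : ℝ in atTop, C * x ^ A * Real.exp (-(x ^ κ)) ≤ 1 := by
  have h := (tendsto_rpow_mul_exp_neg_mul_atTop_nhds_zero (A / κ) 1 one_pos).comp
    (tendsto_rpow_atTop hκ)
  have h2 := h.const_mul C
  rw [mul_zero] at h2
  filter_upwards [h2.eventually (gt_mem_nhds one_pos), eventually_gt_atTop 0] with x hx hx0
  simp only [Function.comp] at hx
  rw [← Real.rpow_mul hx0.le, mul_div_cancel₀ _ hκ.ne'] at hx
  rw [mul_assoc]
  simpa using hx.le

end Numerics

section Numerics

open Filter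

theorem wegner_factor_le {x κ r s s' c₁ R C D B : ℝ} (hx : 1 ≤ x) (hr : 1 ≤ r)
    (hs : 0 < s) (hc₁ : 0 < c₁) (hR0 : 0 ≤ R) (hR : R ≤ c₁ * x ^ κ) (hC : 0 < C) (hD0 : 0 ≤ D)
    (hB : 0 ≤ B) (hD : 2 * D ≤ B * x ^ (-1 / s')) :
    x * R * (C * (2 * D) ^ s * R ^ r) ≤
      c₁ * C * B ^ s * c₁ ^ r * x ^ (-(s / s' - 1) + κ * (1 + r)) := by
  have hx0 : 0 < x := by linarith
  have h1 : (2 * D) ^ s ≤ B ^ s * x ^ (-s / s') := by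
    calc (2 * D) ^ s ≤ (B * x ^ (-1 / s')) ^ s := Real.rpow_le_rpow (by positivity) hD hs.le
      _ = B ^ s * x ^ (-s / s') := by
        rw [Real.mul_rpow hB (by positivity), ← Real.rpow_mul hx0.le]
        congr 2
        ring
  have h2 : R ^ r ≤ c₁ ^ r * x ^ (κ * r) := by
    calc R ^ r ≤ (c₁ * x ^ κ) ^ r := Real.rpow_le_rpow hR0 hR (by linarith)
      _ = _ := by rw [Real.mul_rpow hc₁.le (by positivity), ← Real.rpow_mul hx0.le]
  calc x * R * (C * (2 * D) ^ s * R ^ r)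
      ≤ x * (c₁ * x ^ κ) * (C * (B ^ s * x ^ (-s / s')) * (c₁ ^ r * x ^ (κ * r))) := by gcongr
    _ = c₁ * C * B ^ s * c₁ ^ r * (x ^ (1 : ℝ) * x ^ κ * x ^ (-s / s') * x ^ (κ * r)) := by
        rw [Real.rpow_one]
        ring
    _ = _ := by
        rw [← Real.rpow_add hx0, ← Real.rpow_add hx0, ← Real.rpow_add hx0]
        congr 2
        ring

/-- Here w is the cost of one interval and β that of the failure of localization. The term R w² has
exponent κ(3+2r) − 2γ, which `hκ` puts below −γ(1+ρ). Since w = O(x^{−γ/2}), `hN` makes x w^N at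
most of order x^{−2γ}. -/
theorem sum_of_bounds_le {x γ ρ κ r c₁ c₂ R β w : ℝ} {N : ℕ} (hx : 1 ≤ x) (hγ : 0 < γ)
    (hρ1 : ρ < 1) (hκ1 : κ ≤ 1) (hκ : κ * (3 + 2 * r) ≤ γ * (1 - ρ))
    (hκ' : κ * (1 + r) ≤ γ / 2) (hN : 1 + 2 * γ ≤ N * (γ / 2)) (hc₁ : 0 < c₁) (hc₂ : 0 < c₂)
    (hR : R ≤ c₁ * x ^ κ) (hβ0 : 0 ≤ β) (hβ : β ≤ x ^ (-(1 + 2 * γ)))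
    (hw0 : 0 ≤ w) (hw : w ≤ c₂ * x ^ (-γ + κ * (1 + r))) :
    N * R * (β + w ^ 2) + (x + 1) * (β + w ^ N) ≤
      (N * c₁ + N * (c₁ * c₂ ^ 2) + 2 + 2 * c₂ ^ N) * x ^ (-γ * (1 + ρ)) := by
  have hx0 : 0 < x := by linarith
  have hγρ : γ * ρ ≤ γ := mul_le_of_le_one_right hγ.le hρ1.le
  set y := x ^ (-γ * (1 + ρ)) with hy
  have hxβ : x * β ≤ y := by
    calc x * β ≤ x ^ (1 : ℝ) * x ^ (-(1 + 2 * γ)) := by rw [Real.rpow_one]; gcongr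
      _ = x ^ (-(2 * γ)) := by rw [← Real.rpow_add hx0]; congr 1; ring
      _ ≤ y := Real.rpow_le_rpow_of_exponent_le hx (by linarith)
  have t1 : R * β ≤ c₁ * y := by
    have : x ^ κ ≤ x := by simpa using Real.rpow_le_rpow_of_exponent_le hx hκ1
    calc R * β ≤ c₁ * x * β := by
          refine mul_le_mul_of_nonneg_right (hR.trans ?_) hβ0
          gcongr
      _ = c₁ * (x * β) := by ring
      _ ≤ c₁ * y := by gcongr
  have t2 : R * w ^ 2 ≤ c₁ * c₂ ^ 2 * y := by
    calc R * w ^ 2 ≤ (c₁ * x ^ κ) * (c₂ * x ^ (-γ + κ * (1 + r))) ^ 2 := by gcongr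
      _ = c₁ * c₂ ^ 2 * (x ^ κ * (x ^ (-γ + κ * (1 + r)) * x ^ (-γ + κ * (1 + r)))) := by ring
      _ ≤ c₁ * c₂ ^ 2 * y := by
        rw [← Real.rpow_add hx0, ← Real.rpow_add hx0]
        gcongr
        exact Real.rpow_le_rpow_of_exponent_le hx (by linarith)
  have t3 : (x + 1) * β ≤ 2 * y := by
    have : β ≤ x * β := le_mul_of_one_le_left hβ0 hx
    linarith
  have t4 : (x + 1) * w ^ N ≤ 2 * c₂ ^ N * y := by
    have h1 : w ≤ c₂ * x ^ (-(γ / 2)) := hw.trans (mul_le_mul_of_nonneg_left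
      (Real.rpow_le_rpow_of_exponent_le hx (by linarith)) hc₂.le)
    calc (x + 1) * w ^ N ≤ (2 * x ^ (1 : ℝ)) * (c₂ * x ^ (-(γ / 2))) ^ N := by
          rw [Real.rpow_one]
          gcongr
          linarith
      _ = 2 * c₂ ^ N * (x ^ (1 : ℝ) * x ^ (-(γ / 2) * N)) := by
          rw [mul_pow, Real.rpow_mul hx0.le, Real.rpow_natCast]
          ring
      _ ≤ 2 * c₂ ^ N * y := by
          rw [← Real.rpow_add hx0]
          gcongr
          exact Real.rpow_le_rpow_of_exponent_le hx (by linarith)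
  have hN0 : (0 : ℝ) ≤ N := by positivity
  have t5 := mul_le_mul_of_nonneg_left (add_le_add t1 t2) hN0
  linarith

theorem rpow_le_mul_rpow_of_le {x s s' M ρ ε : ℝ} (hx : 0 < x) (hs : 0 < s) (hM : 0 < M)
    (hρ : 0 < ρ) (hε : x ^ (-1 / s') / M ≤ ε) :
    x ^ (-(s / s' - 1) * (1 + ρ)) ≤ M ^ (s * (1 + ρ)) * (ε ^ s * x) ^ (1 + ρ) := by
  have h1 : x ^ (-(s / s' - 1)) ≤ M ^ s * (ε ^ s * x) := by
    have h2 : x ^ (-1 / s') ≤ M * ε := by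
      rw [div_le_iff₀ hM] at hε
      linarith
    have hε0 : 0 ≤ ε := le_trans (by positivity) hε
    calc x ^ (-(s / s' - 1)) = (x ^ (-1 / s')) ^ s * x ^ (1 : ℝ) := by
          rw [← Real.rpow_mul hx.le, ← Real.rpow_add hx]
          congr 1
          ring
      _ ≤ (M * ε) ^ s * x := by
          rw [Real.rpow_one]
          gcongr
      _ = _ := by rw [Real.mul_rpow hM.le hε0]; ring
  have hε0 : 0 ≤ ε := le_trans (by positivity) hε
  calc _ = (x ^ (-(s / s' - 1))) ^ (1 + ρ) := by rw [← Real.rpow_mul hx.le]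
    _ ≤ (M ^ s * (ε ^ s * x)) ^ (1 + ρ) := Real.rpow_le_rpow (by positivity) h1 (by linarith)
    _ = _ := by rw [Real.mul_rpow (by positivity) (by positivity), ← Real.rpow_mul hM.le]

/-- The exponent 2 + 2/s' leaves a spare factor 1/x beyond ε² ≈ x^{−2/s'}, which absorbs the
constants. -/
theorem mul_rpow_le_sq {x s' K M ε : ℝ} (hx : 0 < x) (hM : 0 < M)
    (hxK : 12 * K ^ 2 * M ^ 2 ≤ x) (hε : x ^ (-1 / s') / M ≤ ε) :
    12 * x * K ^ 2 * x ^ (-(2 + 2 / s')) ≤ ε ^ 2 := by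
  have h1 : x * x ^ (-(2 + 2 / s')) = x ^ (-(1 : ℝ)) * (x ^ (-1 / s')) ^ 2 := by
    rw [← Real.rpow_natCast (x ^ (-1 / s')) 2, ← Real.rpow_mul hx.le, ← Real.rpow_add hx]
    nth_rewrite 1 [← Real.rpow_one x]
    rw [← Real.rpow_add hx]
    congr 1
    push_cast
    ring
  have h2 : (x ^ (-1 / s')) ^ 2 ≤ (M * ε) ^ 2 := by
    rw [div_le_iff₀ hM] at hε
    exact pow_le_pow_left₀ (by positivity) (by linarith) 2
  calc 12 * x * K ^ 2 * x ^ (-(2 + 2 / s')) =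
        12 * K ^ 2 * (x ^ (-(1 : ℝ)) * (x ^ (-1 / s')) ^ 2) := by
        rw [← h1]
        ring
    _ ≤ 12 * K ^ 2 * (x ^ (-(1 : ℝ)) * (M * ε) ^ 2) := by gcongr
    _ = (12 * K ^ 2 * M ^ 2) * x⁻¹ * ε ^ 2 := by rw [Real.rpow_neg_one]; ring
    _ ≤ x * x⁻¹ * ε ^ 2 := by gcongr
    _ = ε ^ 2 := by rw [mul_inv_cancel₀ hx.ne', one_mul]

theorem mul_rpow_le_one {x s' : ℝ} (hx : 4 ≤ x) (hs' : 0 < s') :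
    4 * x * x ^ (-(2 + 2 / s')) ≤ 1 := by
  have hx0 : 0 < x := by linarith
  have h1 : x * x ^ (-(2 + 2 / s')) ≤ x⁻¹ := by
    rw [← Real.rpow_neg_one]
    nth_rewrite 1 [← Real.rpow_one x]
    rw [← Real.rpow_add hx0]
    refine Real.rpow_le_rpow_of_exponent_le (by linarith) ?_
    have : 0 < 2 / s' := by positivity
    linarith
  have h2 : x⁻¹ ≤ 1 / 4 := by
    rw [← one_div]
    exact one_div_le_one_div_of_le (by norm_num) hx
  linarith

theorem mul_div_exp_le {x y κ b q C : ℝ} (hx : 0 < x) (hxy : x ^ κ ≤ y)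
    (h : |C| * x ^ (1 + b + q) * Real.exp (-(x ^ (κ * (1 / 2)))) ≤ 1) :
    x * (|C| / (Real.exp (y ^ ((1 : ℝ) / 2)) * x ^ (-b))) ≤ x ^ (-q) := by
  have h1 : Real.exp (x ^ (κ * (1 / 2))) ≤ Real.exp (y ^ ((1 : ℝ) / 2)) := by
    refine Real.exp_le_exp.mpr ?_
    rw [Real.rpow_mul hx.le]
    exact Real.rpow_le_rpow (by positivity) hxy (by norm_num)
  calc _ ≤ x * (|C| / (Real.exp (x ^ (κ * (1 / 2))) * x ^ (-b))) := by gcongr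
    _ = |C| * (x ^ (1 : ℝ) * x ^ b) * Real.exp (-(x ^ (κ * (1 / 2)))) := by
        rw [Real.rpow_neg hx.le, Real.exp_neg, Real.rpow_one]
        field_simp
    _ = (|C| * x ^ (1 + b + q) * Real.exp (-(x ^ (κ * (1 / 2))))) * x ^ (-q) := by
        rw [← Real.rpow_add hx, show (1 : ℝ) + b = (1 + b + q) + -q by ring,
          Real.rpow_add hx, show (1 + b + q) + -q + q = 1 + b + q by ring]
        ring
    _ ≤ 1 * x ^ (-q) := by gcongr
    _ = _ := one_mul _

end Numerics

/-! ### Choice of parameters and conclusion -/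

theorem exists_uniform_margin {I J : Set ℝ} (hI : IsOpen I) (hJ : IsCompact J) (hJI : J ⊆ I) :
    ∃ δ F : ℝ, 0 < δ ∧ 0 ≤ F ∧ ∀ E ∈ J, |E| ≤ F ∧
      ∀ D ≤ δ, Set.Icc (E - D) (E + D) ⊆ I := by
  obtain ⟨δ, hδ, hsub⟩ := hJ.exists_cthickening_subset_open hI hJI
  obtain ⟨F, hF⟩ := hJ.isBounded.exists_norm_le
  refine ⟨δ, max F 0, hδ, le_max_right _ _, fun E hE => ⟨(hF E hE).trans (le_max_left _ _),
    fun D hD => ?_⟩⟩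
  rw [← Real.closedBall_eq_Icc]
  exact (Metric.closedBall_subset_closedBall hD).trans
    ((Metric.closedBall_subset_cthickening hE δ).trans hsub)

theorem mainTheorem5 {Ω : Type*} [MeasurableSpace Ω] (μ : Measure Ω) [IsProbabilityMeasure μ]
    (a V : ℤ → Ω → ℝ) (ha : ∀ n, Measurable (a n)) (hV : ∀ n, Measurable (V n))
    (hbdd : BoundedCoefficients μ a V)
    (hind : IndependentAtDistance μ a V ∨ IsRandomHopping μ a V)
    (I : Set ℝ) (hI : IsOpen I) (hIc : IsCompact (closure I))
    (s : ℝ) (hs : 0 < s) (hs1 : s ≤ 1)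
    (hW : WegnerEstimate μ a V I s) (hLoc : Localized μ a V I)
    (J : Set ℝ) (hJ : IsCompact J) (hJI : J ⊆ I)
    (s' M ρ : ℝ) (hs' : 0 < s') (hs's : s' < s) (hM : 1 < M) (hρ : 0 < ρ) (hρ1 : ρ < 1) :
    ∃ (L₀ : ℕ) (C : ℝ), 0 < L₀ ∧ 0 < C ∧ ∀ E ∈ J, ∀ L : ℕ, L₀ ≤ L →
      ∀ ε ∈ Set.Icc ((L : ℝ) ^ (-1 / s') / M) (M * (L : ℝ) ^ (-1 / s')),
        ∑' k : {k : ℕ // 2 ≤ k},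
            μ {ω | ((k : ℕ) : ℝ) ≤
              traceSpectralProj (randomJacobi a V 1 L ω) (Set.Icc (E - ε) (E + ε))} ≤
          ENNReal.ofReal (C * (ε ^ s * (L : ℝ)) ^ (1 + ρ)) := by
  obtain ⟨K, hK, hbdd⟩ := hbdd
  obtain ⟨S, hS, hind⟩ : ∃ S : ℕ, 1 ≤ S ∧ IndependentEigenvalues μ a V S := by
    rcases hind with h | h
    · exact h.independentEigenvalues
    · exact ⟨1, le_rfl, h.independentEigenvalues ha⟩
  obtain ⟨CW, r, hCW, hr, hW⟩ := hW
  -- One exponent is enough: with ℓ ≥ L^κ, the factor exp(−L^{κ/2}) beats every power of L.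
  obtain ⟨CL, hLoc⟩ := hLoc (1 / 2) (by norm_num) (by norm_num)
  obtain ⟨δ, F, hδ, hF0, hmargin⟩ := exists_uniform_margin hI hJ hJI
  have hM0 : 0 < M := by linarith
  set γ := s / s' - 1 with hγdef
  have hγ : 0 < γ := by
    have : 1 < s / s' := (one_lt_div hs').mpr hs's
    linarith
  set κ := min 1 (γ * (1 - ρ) / (3 + 2 * r)) with hκdef
  have hκ0 : 0 < κ := by
    have : 0 < 1 - ρ := by linarith
    exact lt_min one_pos (by positivity)
  have hκ1 : κ ≤ 1 := min_le_left _ _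
  have hκ : κ * (3 + 2 * r) ≤ γ * (1 - ρ) := by
    rw [← le_div_iff₀ (by positivity)]
    exact min_le_right _ _
  have hκ' : κ * (1 + r) ≤ γ / 2 := by
    have : 0 < γ * ρ := by positivity
    linarith
  obtain ⟨N, hN⟩ := exists_nat_ge ((1 + 2 * γ) / (γ / 2))
  rw [div_le_iff₀ (by positivity)] at hN
  set G : ℝ := 4 * (S + 1) * (K * ((F + 1) + 2 * K) + 1) ^ (2 * S + 2) with hG
  have hG0 : 0 < G := by positivity
  -- D = C₀ε: the 12 gives 6 · 2ε ≤ D, and 32G makes the ratio term 16G/C₀ of the tunneling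
  -- condition at most 1/2.
  set C₀ : ℝ := max 12 (32 * G) with hC₀
  have hC₀12 : 12 ≤ C₀ := le_max_left _ _
  have hC₀G : 32 * G ≤ C₀ := le_max_right _ _
  have hC₀0 : 0 < C₀ := by linarith
  -- The three bounds keep |E| + 2ε ≤ F + 1, keep the window [E−D, E+D] inside `I`, and make the
  -- energy-shift term of the tunneling condition at most 1/2.
  set ε₁ : ℝ := min (1 / 2) (min (δ / C₀) (1 / (8 * G * S * K + 1))) with hε₁
  have hε₁0 : 0 < ε₁ := by positivity
  set b : ℝ := 2 + 2 / s' with hb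
  -- From 2ℓ + S + 1 ≤ 4L^κ + S + 1 ≤ (5 + S)L^κ.
  set c₁ : ℝ := 5 + S with hc₁
  set c₂ : ℝ := c₁ * CW * (2 * (C₀ * M)) ^ s * c₁ ^ r with hc₂
  have hc₁0 : 0 < c₁ := by positivity
  have hc₂0 : 0 < c₂ := by positivity
  set C₁ : ℝ := N * c₁ + N * (c₁ * c₂ ^ 2) + 2 + 2 * c₂ ^ N with hC₁
  have hC₁0 : 0 < C₁ := by positivity
  have hsmallε : ∀ᶠ x : ℝ in Filter.atTop, M * x ^ (-1 / s') ≤ ε₁ := by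
    have h := (tendsto_rpow_neg_atTop (by positivity : 0 < 1 / s')).const_mul M
    rw [mul_zero] at h
    filter_upwards [h.eventually (ge_mem_nhds hε₁0)] with x hx
    rwa [neg_div]
  have hev : ∀ᶠ L : ℕ in Filter.atTop, (4 : ℝ) ≤ L ∧ 12 * K ^ 2 * M ^ 2 ≤ (L : ℝ) ∧
      M * (L : ℝ) ^ (-1 / s') ≤ ε₁ ∧
      |CL| * (L : ℝ) ^ (1 + b + (1 + 2 * γ)) * Real.exp (-((L : ℝ) ^ (κ * (1 / 2)))) ≤ 1 :=
    tendsto_natCast_atTop_atTop.eventually ((Filter.eventually_ge_atTop 4).and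
      ((Filter.eventually_ge_atTop _).and (hsmallε.and
        (eventually_mul_rpow_mul_exp_le (by positivity) |CL| (1 + b + (1 + 2 * γ))))))
  obtain ⟨L₁, hL₁⟩ := Filter.eventually_atTop.mp hev
  refine ⟨L₁ + 1, C₁ * M ^ (s * (1 + ρ)), Nat.succ_pos _, by positivity, ?_⟩
  intro E hE L hL ε hε
  obtain ⟨hx4, hxK, hxε, hxexp⟩ := hL₁ L (by omega)
  obtain ⟨hEF, hEI⟩ := hmargin E hE
  set x : ℝ := (L : ℝ) with hxdef
  have hx1 : 1 ≤ x := by linarith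
  have hx0 : 0 < x := by linarith
  have hε0 : 0 < ε := lt_of_lt_of_le (by positivity) hε.1
  have hεε₁ : ε ≤ ε₁ := hε.2.trans hxε
  have hε_half : ε ≤ 1 / 2 := hεε₁.trans (min_le_left _ _)
  have hε12 : 12 * ε ≤ C₀ * ε := mul_le_mul_of_nonneg_right hC₀12 hε0.le
  have hεC₀ : ε ≤ C₀ * ε := by linarith
  have hεδ : C₀ * ε ≤ δ := by
    have : ε ≤ δ / C₀ := hεε₁.trans ((min_le_right _ _).trans (min_le_left _ _))
    rw [le_div_iff₀ hC₀0] at this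
    linarith
  have hεG : 8 * G * S * K * ε ≤ 1 := by
    have : ε ≤ 1 / (8 * G * S * K + 1) :=
      hεε₁.trans ((min_le_right _ _).trans (min_le_right _ _))
    rw [le_div_iff₀ (by positivity)] at this
    linarith
  set τ : ℝ := x ^ (-b) with hτdef
  have hτ0 : 0 < τ := by positivity
  set ℓ : ℕ := ⌈x ^ κ⌉₊ with hℓdef
  have hxκ1 : 1 ≤ x ^ κ := Real.one_le_rpow hx1 hκ0.le
  have hℓ1 : x ^ κ ≤ ℓ := Nat.le_ceil _
  have hℓ2 : (ℓ : ℝ) ≤ 2 * x ^ κ := by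
    have := (Nat.ceil_lt_add_one (by positivity : 0 ≤ x ^ κ)).le
    linarith
  have hτ : 12 * x * K ^ 2 * τ ≤ ε ^ 2 := mul_rpow_le_sq hx0 hM0 hxK hε.1
  have hτ' : 4 * x * τ ≤ 1 := mul_rpow_le_one hx4 hs'
  have hsmall : G * (8 * (2 * ε) / (C₀ * ε) + S * (K * (2 * (2 * ε)))) ≤ 1 := by
    have h1 : 8 * (2 * ε) / (C₀ * ε) = 16 / C₀ := by
      field_simp
      ring
    have h2 : G * (16 / C₀) ≤ 1 / 2 := by
      rw [← mul_div_assoc, div_le_iff₀ hC₀0]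
      linarith
    rw [h1, mul_add]
    have : G * (S * (K * (2 * (2 * ε)))) = 8 * G * S * K * ε / 2 := by ring
    linarith
  set β : ℝ := x * (|CL| / (Real.exp ((ℓ : ℝ) ^ ((1 : ℝ) / 2)) * τ)) with hβdef
  have hβ0 : 0 ≤ β := by positivity
  have hβ : β ≤ x ^ (-(1 + 2 * γ)) :=
    mul_div_exp_le hx0 hℓ1 hxexp
  have hbad := measure_exists_lt_cfc_le (μ := μ) ha hV (by norm_num : (0 : ℝ) < 1 / 2) hLoc
    (isClosed_Icc : IsClosed (Set.Icc (E - ε) (E + ε)))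
    (Set.nonempty_Icc.mpr (by linarith)) (hEI ε (hεC₀.trans hεδ)) L ℓ hτ0
  have hbad' : (L : ENNReal) * (ENNReal.ofReal CL /
      ENNReal.ofReal (Real.exp ((ℓ : ℝ) ^ ((1 : ℝ) / 2)) * τ)) ≤ ENNReal.ofReal β := by
    rw [hβdef, ENNReal.ofReal_mul hx0.le, hxdef, ENNReal.ofReal_natCast,
      ENNReal.ofReal_div_of_pos (by positivity)]
    gcongr
    exact le_abs_self _
  set R : ℝ := ((2 * ℓ + S : ℕ) : ℝ) + 1 with hRdef
  have hR0 : 0 ≤ R := by positivity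
  have hR : R ≤ c₁ * x ^ κ := by
    rw [hRdef, hc₁]
    push_cast
    have hS0 : (0 : ℝ) ≤ S := by positivity
    have := mul_le_mul_of_nonneg_left hxκ1 hS0
    linarith
  set w : ℝ := x * R * (CW * (2 * (C₀ * ε)) ^ s * R ^ r) with hwdef
  have hw0 : 0 ≤ w := by positivity
  have hw : w ≤ c₂ * x ^ (-γ + κ * (1 + r)) :=
    wegner_factor_le hx1 hr hs hc₁0 hR0 hR hCW (by positivity) (by positivity) (by
      have := mul_le_mul_of_nonneg_left hε.2 hC₀0.le
      linarith)
  have hsep := fun n : ℕ => measure_hasSeparatedEigenvalues_le hind hCW hr hW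
    (by positivity : 0 ≤ C₀ * ε) (hEI _ hεδ) L (2 * ℓ + S) n
  refine (tsum_measure_traceSpectralProj_le (N := N) hK hbdd hS hε0 hτ0 hτ hτ'
    (D := C₀ * ε) (F := F + 1) (by linarith) (by linarith) hsmall (hbad.trans hbad') (hsep 2)
    (hsep N)).trans ?_
  rw [← ENNReal.ofReal_add hβ0 (by positivity), ← ENNReal.ofReal_add hβ0 (by positivity),
    ← ENNReal.ofReal_natCast, ← ENNReal.ofReal_natCast L, ← ENNReal.ofReal_one,
    ← ENNReal.ofReal_add (by positivity) zero_le_one, ← ENNReal.ofReal_mul (by positivity),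
    ← ENNReal.ofReal_mul (by positivity), ← ENNReal.ofReal_add (by positivity) (by positivity)]
  refine ENNReal.ofReal_le_ofReal ?_
  have hfinal := sum_of_bounds_le (N := N) hx1 hγ hρ1 hκ1 hκ hκ' hN hc₁0 hc₂0 hR hβ0 hβ hw0 hw
  have hNR : ((N * (2 * ℓ + S + 1) : ℕ) : ℝ) = N * R := by
    rw [hRdef]
    push_cast
    ring
  rw [hNR]
  refine hfinal.trans ?_
  rw [mul_assoc]
  exact mul_le_mul_of_nonneg_left (rpow_le_mul_rpow_of_le hx0 hs hM0 hρ hε.1) hC₁0.le
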